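/- \textbf{Notation.} Let $d,N\ge 1$ and $M\ge 0$ be integers. For a multi-index $\alpha=(\alpha_1,\dots,\alpha_d)$ of non-negative integers put $|\alpha|=\alpha_1+\dots+\alpha_d$, $\alpha!=\alpha_1!\cdots\alpha_d!$, $x^{\alpha}=x_1^{\alpha_1}\cdots x_d^{\alpha_d}$, and let $D^{\alpha}=\partial_{1}^{\alpha_1}\cdots\partial_{d}^{\alpha_d}$; $|x|$ is the Euclidean norm on $\mathbf{R}^d$. For $s\ge 0$ let $H^s(\mathbf{R}^d)=\{f\in L^2(\mathbf{R}^d):(1+|\omega|^2)^{s/2}\widehat f(\omega)\in L^2(\mathbf{R}^d)\}$. Let $L_{N,M}(\mathbf{R}^d)$ be the set of functions $f:\mathbf{R}^d\to\mathbf{R}$ such that \begin{enumerate} \item $f$ is continuous and $f\in H^s(\mathbf{R}^d)$ for some $s>M+d/2$ (so that $f\in C^M(\mathbf{R}^d)$); \item there are constants $C>0$ and $0\le\epsilon<1$ such that $|D^{\alpha}f(x)|\le C(1+|x|)^{-d-N-|\alpha|+\epsilon}$ for all $x\in\mathbf{R}^d$ and all $|\alpha|\le M$; \item $\int_{\mathbf{R}^d}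 x^{\beta}D^{\alpha}f(x)\,dx=0$ whenever $|\alpha|\le M-1$ and $|\beta|<N+|\alpha|$. \end{enumerate} For $1\le i\le d$ the Riesz transform $\mathcal{R}_i$ is the principal value integral $$\mathcal{R}_i f(x)=C_d\lim_{\eta\to 0^+}\int_{|x-y|>\eta}f(y)\,\frac{x_i-y_i}{|x-y|^{d+1}}\,dy,\qquad C_d=\frac{\Gamma\left(\frac{d+1}{2}\right)}{\pi^{(d+1)/2}},$$ and the higher-order Riesz transform of multi-index $\alpha$ is $\mathcal{R}^{\alpha}f=\sqrt{|\alpha|!/\alpha!}\;\mathcal{R}_1^{\alpha_1}\cdots\mathcal{R}_d^{\alpha_d}f$, where $\mathcal{R}_i^{k}$ is the $k$-fold application of $\mathcal{R}_i$. \textbf{Theorem.} Let $f\in L_{N,M}(\mathbf{R}^d)$. Then there are constants $0<\epsilon<1$ and $C>0$ such that, for every multi-index $\alpha$ with $1\le|\alpha|\le M$, the function $\mathcal{R}^{\alpha}f$ is well defined at every point (the integrals over $|x-y|>\eta$ converge absolutely and the limit as $\eta\to0^+$ exists, at every point and at each step of the iteration), $$|\mathcal{R}^{\alpha}f(x)|\le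 C(1+|x|)^{-d-N+\epsilon}\qquad\text{for all }x\in\mathbf{R}^d,$$ and $\mathcal{R}^{\alpha}f$ has vanishing moments up to degree $N-1$: for every multi-index $\beta$ with $|\beta|\le N-1$ the function $x^{\beta}\mathcal{R}^{\alpha}f(x)$ is integrable and $\int_{\mathbf{R}^d}x^{\beta}\mathcal{R}^{\alpha}f(x)\,dx=0$. -/

import Mathlib

open MeasureTheory Filter Topology
open scoped FourierTransform

noncomputable section

namespace RieszDecay

/-- Euclidean space `ℝ^d` with its Euclidean norm and Lebesgue measure. -/
abbrev Rd (d : ℕ) : Type := EuclideanSpace ℝ (Fin d)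

/-- The order `|α| = α₁ + ⋯ + α_d` of a multi-index. -/
def order {d : ℕ} (α : Fin d → ℕ) : ℕ := ∑ i, α i

/-- The factorial `α! = α₁! ⋯ α_d!` of a multi-index. -/
def multiFactorial {d : ℕ} (α : Fin d → ℕ) : ℕ := ∏ i, (α i).factorial

/-- The monomial `x^β = x₁^β₁ ⋯ x_d^β_d`. -/
def monomial {d : ℕ} (β : Fin d → ℕ) (x : Rd d) : ℝ := ∏ i, x i ^ β i

/-- The list `[1, …, 1, 2, …, 2, …, d, …, d]` in which the index `i` occurs `α i` times: an
operator `T₁^α₁ ⋯ T_d^α_d` is the composition of the operators `T_i`, `i` running through this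
list, the last one being applied first. -/
def word {d : ℕ} (α : Fin d → ℕ) : List (Fin d) :=
  (List.finRange d).flatMap fun i => List.replicate (α i) i

/-- Classical iterated partial derivatives `∂_{i₁} ⋯ ∂_{i_k} f`. -/
def partialWord {d : ℕ} : List (Fin d) → (Rd d → ℝ) → Rd d → ℝ
  | [], f => f
  | i :: w, f => fun x => lineDeriv ℝ (partialWord w f) x (EuclideanSpace.single i (1 : ℝ))

/-- The partial derivative `D^α f = ∂₁^α₁ ⋯ ∂_d^α_d f`. -/
def multiDeriv {d : ℕ} (α : Fin d → ℕ) (f : Rd d → ℝ) : Rd d → ℝ := partialWord (word α) f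

/-- `f` belongs to `H^s(ℝ^d)`: it is in `L²` and `(1 + |ω|²)^{s/2} f̂(ω)` is in `L²`, where `f̂` is
the Fourier–Plancherel transform of `f`. -/
def MemH {d : ℕ} (s : ℝ) (f : Rd d → ℝ) : Prop :=
  ∃ hf : MemLp (fun x => (f x : ℂ)) 2 (volume : Measure (Rd d)),
    MemLp (fun ω : Rd d =>
      (((1 + ‖ω‖ ^ 2) ^ (s / 2) : ℝ) : ℂ) * (𝓕 (hf.toLp (fun x => (f x : ℂ)))) ω) 2 volume

/-- The class `L_{N,M}(ℝ^d)`. -/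
structure MemL {d : ℕ} (N M : ℕ) (f : Rd d → ℝ) : Prop where
  sobolev : ∃ s : ℝ, (M : ℝ) + (d : ℝ) / 2 < s ∧ MemH s f
  continuous : Continuous f
  decay : ∃ C ε : ℝ, 0 < C ∧ 0 ≤ ε ∧ ε < 1 ∧ ∀ α : Fin d → ℕ, order α ≤ M → ∀ x : Rd d,
    |multiDeriv α f x| ≤ C * (1 + ‖x‖) ^ (-(d : ℝ) - (N : ℝ) - (order α : ℝ) + ε)
  moments : ∀ α β : Fin d → ℕ, order α + 1 ≤ M → order β < N + order α →
    ∫ x : Rd d, monomial β x * multiDeriv α f x = 0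

/-- The normalizing constant `C_d = Γ((d+1)/2) / π^{(d+1)/2}`, for which the `i`-th Riesz transform
has the Fourier multiplier `-j ω_i / |ω|`. -/
def rieszConst (d : ℕ) : ℝ := Real.Gamma (((d : ℝ) + 1) / 2) / Real.pi ^ (((d : ℝ) + 1) / 2)

/-- The integrand `f(y) (x_i - y_i) / |x - y|^{d+1}`. -/
def rieszIntegrand {d : ℕ} (i : Fin d) (f : Rd d → ℝ) (x y : Rd d) : ℝ :=
  f y * ((x i - y i) / ‖x - y‖ ^ (d + 1))

/-- The truncated integral over `{y : |x - y| > η}`. -/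
def truncRiesz {d : ℕ} (i : Fin d) (f : Rd d → ℝ) (x : Rd d) (η : ℝ) : ℝ :=
  ∫ y in {y : Rd d | η < ‖x - y‖}, rieszIntegrand i f x y

/-- The principal value defining `R_i f (x)` exists: the truncated integrals converge absolutely
and have a limit as the truncation radius tends to `0`. -/
def RieszExistsAt {d : ℕ} (i : Fin d) (f : Rd d → ℝ) (x : Rd d) : Prop :=
  (∀ η : ℝ, 0 < η →
    IntegrableOn (rieszIntegrand i f x) {y : Rd d | η < ‖x - y‖} volume) ∧
  ∃ l : ℝ, Tendsto (truncRiesz i f x) (𝓝[>] 0) (𝓝 l)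

/-- The `i`-th Riesz transform `R_i f`, a principal value integral (meaningful at `x` when
`RieszExistsAt i f x` holds). -/
def riesz {d : ℕ} (i : Fin d) (f : Rd d → ℝ) (x : Rd d) : ℝ :=
  rieszConst d * limUnder (𝓝[>] (0 : ℝ)) (truncRiesz i f x)

/-- Iterated Riesz transforms `R_{i₁} ⋯ R_{i_k} f`. -/
def rieszWord {d : ℕ} : List (Fin d) → (Rd d → ℝ) → Rd d → ℝ
  | [], f => f
  | i :: w, f => riesz i (rieszWord w f)

/-- All the principal values in `R_{i₁} ⋯ R_{i_k} f` exist, at every step and at every point. -/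
def RieszWordExists {d : ℕ} : List (Fin d) → (Rd d → ℝ) → Prop
  | [], _ => True
  | i :: w, f => RieszWordExists w f ∧ ∀ x : Rd d, RieszExistsAt i (rieszWord w f) x

/-- The higher-order Riesz transform `R^α f = √(|α|! / α!) R₁^α₁ ⋯ R_d^α_d f`. -/
def higherRiesz {d : ℕ} (α : Fin d → ℕ) (f : Rd d → ℝ) (x : Rd d) : ℝ :=
  Real.sqrt (((order α).factorial : ℝ) / (multiFactorial α : ℝ)) * rieszWord (word α) f x

/-- The higher-order Riesz transform `R^α f` is well defined everywhere. -/
def HigherRieszExists {d : ℕ} (α : Fin d → ℕ) (f : Rd d → ℝ) : Prop :=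
  RieszWordExists (word α) f

end RieszDecay

end

/-!
The proof takes place in real space; the Fourier transform only enters through the Sobolev
embedding `contDiff_of_memH`, which makes `f` a `C^M` function.

A smooth even cutoff splits the kernel `z_i / |z|^{d+1}` into a singular part supported in
`|z| ≤ 1/2` and a smooth part all of whose derivatives are bounded. As the kernel is odd, the
principal value of a decaying `C¹` function exists and equals the absolutely convergent expression
`absRiesz`, which subtracts `f x` on the singular part (`C1Decay.tendsto_truncRiesz`). This operator
commutes with differentiation and with dilations, and it is antisymmetric.

The main estimate is `MomentsVanish.exists_abs_integral_comp_smul_mul_le`: if the moments of `f` of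
order at most `n` vanish and `|x|^{n+δ} f` is integrable, then pairing `f(r ·)` with a function
having bounded derivatives only sees the Taylor remainder of that function, and is
`O(r^{-d-n-δ})`. It is used twice.

* For the decay (`C1Decay.decay_absRiesz`), `x` is rescaled to the unit sphere by `r = |x|`. The
  singular part of the kernel meets `f(r ·)` away from the origin only, where the gradient of `f` is
  small; the smooth part of the kernel is paired with `f(r ·)`.
* For the moments (`C1Decay.momentsVanish_absRiesz`), `x^β R_i f` is cut off at scale `R`. By
  antisymmetry and dilation the cut-off moment is `R^{d+|β|}` times a pairing of `f(R ·)` with the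
  Riesz transform of a fixed test function, which has bounded derivatives. It is therefore
  `O(R^{-δ})`.

Since derivatives pass through the Riesz transform, these two facts show that a Riesz transform
preserves a class of functions defined by decay and vanishing moments of the derivatives
(`RegDecay.riesz`), at the cost of one derivative and an arbitrarily small power. The hypothesis
provides `M` derivatives, enough for `M` successive transforms.
-/

namespace RieszDecay

noncomputable section

/-! ### Sobolev embedding -/

section

open scoped SchwartzMap

/-- If the `L²` Fourier transform of `g` is integrable, then `g` is almost everywhere its
inverse Fourier integral. -/
theorem ae_eq_fourierInv_of_integrable {d : ℕ} (g u : Lp (α := Rd d) ℂ 2) (hgu : 𝓕 g = u)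
    (hu : Integrable (fun w => u w)) :
    (g : Rd d → ℂ) =ᵐ[volume] 𝓕⁻ (u : Rd d → ℂ) := by
  have hg : g = 𝓕⁻ u := by rw [← hgu, FourierTransform.fourierInv_fourier_eq]
  have hL : Continuous fun p : Rd d × Rd d => (-innerₗ (Rd d)) p.1 p.2 := by
    simp only [LinearMap.neg_apply, innerₗ_apply_apply]; fun_prop
  have hcont : Continuous (𝓕⁻ (u : Rd d → ℂ)) :=
    VectorFourier.fourierIntegral_continuous (L := -innerₗ (Rd d)) (μ := volume)
      Real.continuous_fourierChar hL hu
  apply ae_eq_of_integral_contDiff_smul_eq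
  · exact (Lp.memLp g).locallyIntegrable (by norm_num)
  · exact hcont.locallyIntegrable
  intro φ hφ hφc
  have hψc : HasCompactSupport (fun x => (φ x : ℂ)) :=
    hφc.comp_left (g := fun t : ℝ => (t : ℂ)) rfl
  let ψ : 𝓢(Rd d, ℂ) := hψc.toSchwartzMap (Complex.ofRealCLM.contDiff.comp hφ)
  have hψ : ∀ x, ψ x = (φ x : ℂ) := fun x => rfl
  have h1 : (Lp.toTemperedDistribution g) ψ = (Lp.toTemperedDistribution u) (𝓕⁻ ψ) := by
    rw [hg, ← Lp.fourierInv_toTemperedDistribution_eq]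
    rfl
  rw [Lp.toTemperedDistribution_apply, Lp.toTemperedDistribution_apply] at h1
  have h2 := VectorFourier.integral_fourierIntegral_smul_eq_flip (L := -innerₗ (Rd d))
    (μ := volume) (ν := volume) (f := fun x => ψ x) (g := fun x => u x)
    Real.continuous_fourierChar hL ψ.integrable hu
  have h3 : ∀ x, VectorFourier.fourierIntegral Real.fourierChar volume (-innerₗ (Rd d)).flip
      (fun x => u x) x = 𝓕⁻ (u : Rd d → ℂ) x := by
    intro x
    rw [Real.fourierInv_eq]
    simp only [VectorFourier.fourierIntegral, LinearMap.flip_apply, LinearMap.neg_apply,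
      innerₗ_apply_apply, neg_neg]
    refine integral_congr_ae (Eventually.of_forall fun v => ?_)
    simp only [real_inner_comm]
  have h4 : ∀ x, VectorFourier.fourierIntegral Real.fourierChar volume (-innerₗ (Rd d))
      (fun x => ψ x) x = (𝓕⁻ ψ) x := by
    intro x
    rw [SchwartzMap.fourierInv_coe]
    rfl
  simp only [h3, h4] at h2
  rw [h2] at h1
  simpa only [hψ, smul_eq_mul, Complex.real_smul] using h1

/-- Sobolev embedding `H^s ⊆ C^M` for `s > M + d/2`. -/
theorem contDiff_of_memH {d M : ℕ} {s : ℝ} {f : Rd d → ℝ} (hs : (M : ℝ) + (d : ℝ) / 2 < s)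
    (hf : MemH s f) (hfc : Continuous f) : ContDiff ℝ M f := by
  obtain ⟨hf2, hw⟩ := hf
  set g : Lp (α := Rd d) ℂ 2 volume := hf2.toLp (fun x => (f x : ℂ))
  set u : Lp (α := Rd d) ℂ 2 volume := 𝓕 g
  have hint : ∀ n : ℕ, n ≤ M → Integrable (fun w : Rd d => ‖w‖ ^ n * ‖u w‖) volume := by
    intro n hn
    have hn' : (n : ℝ) ≤ M := by exact_mod_cast hn
    -- `u` is integrable against `‖w‖ ^ n` by the Cauchy-Schwarz inequality
    have hm : MemLp (fun w : Rd d => (1 + ‖w‖ ^ 2) ^ (((n : ℝ) - s) / 2)) 2 volume := by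
      rw [memLp_two_iff_integrable_sq_norm (by
        apply Continuous.aestronglyMeasurable
        refine Continuous.rpow_const (by fun_prop) fun x => Or.inl (by positivity))]
      have := integrable_rpow_neg_one_add_norm_sq (E := Rd d) (μ := volume) (r := 2 * (s - n))
        (by simp; linarith)
      refine this.congr (Eventually.of_forall fun x => ?_)
      simp only
      rw [Real.norm_of_nonneg (by positivity), ← Real.rpow_mul_natCast (by positivity)]
      congr 1
      push_cast; ring
    have h1 := hm.integrable_mul hw.norm
    refine h1.mono' (by
      exact (Continuous.aestronglyMeasurable (by fun_prop)).mul
        (Lp.aestronglyMeasurable u).norm) (Eventually.of_forall fun w => ?_)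
    have hpos : (0 : ℝ) < 1 + ‖w‖ ^ 2 := by positivity
    simp only [Pi.mul_apply]
    rw [norm_mul, norm_mul, Complex.norm_real, norm_norm, norm_pow, norm_norm,
      Real.norm_of_nonneg (Real.rpow_nonneg hpos.le _), ← mul_assoc, ← Real.rpow_add hpos]
    gcongr
    have : ((n : ℝ) - s) / 2 + s / 2 = (1 / 2) * n := by ring
    rw [this, Real.rpow_mul hpos.le, Real.rpow_natCast, ← Real.sqrt_eq_rpow]
    gcongr
    apply Real.le_sqrt_of_sq_le; linarith
  have h0 : Integrable (fun w => u w) volume := by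
    have := hint 0 (Nat.zero_le _)
    simp only [pow_zero, one_mul] at this
    exact (integrable_norm_iff (Lp.aestronglyMeasurable u)).1 this
  have hae := ae_eq_fourierInv_of_integrable g u rfl h0
  have hcd : ContDiff ℝ M (𝓕⁻ (u : Rd d → ℂ)) := by
    have h5 : ContDiff ℝ (M : ℕ∞) (𝓕 (u : Rd d → ℂ)) :=
      Real.contDiff_fourier (fun n hn => hint n (by exact_mod_cast hn))
    have h6 : 𝓕⁻ (u : Rd d → ℂ) = fun x => 𝓕 (u : Rd d → ℂ) (-x) := by
      ext x; exact Real.fourierInv_eq_fourier_neg _ _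
    rw [h6]
    exact h5.comp contDiff_neg
  have heq : (fun x => (f x : ℂ)) = 𝓕⁻ (u : Rd d → ℂ) := by
    apply (Continuous.ae_eq_iff_eq volume (Complex.continuous_ofReal.comp hfc) hcd.continuous).1
    exact hf2.coeFn_toLp.symm.trans hae
  have : f = fun x => Complex.reCLM (𝓕⁻ (u : Rd d → ℂ) x) := by
    ext x; rw [← heq]; simp
  rw [this]
  exact Complex.reCLM.contDiff.comp hcd

end

/-! ### Splitting the Riesz kernel -/

section

/-- The Riesz kernel `z_i / |z|^{d+1}`, without its normalizing constant. -/
def rieszKernel {d : ℕ} (i : Fin d) (z : Rd d) : ℝ := z i / ‖z‖ ^ (d + 1)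

/-- A fixed smooth even cutoff, equal to `1` on `|z| ≤ 1/4` and to `0` on `|z| ≥ 1/2`. -/
def cutoff (d : ℕ) : ContDiffBump (0 : Rd d) := ⟨1 / 4, 1 / 2, by norm_num, by norm_num⟩

/-- The singular part of the Riesz kernel, supported in `|z| ≤ 1/2`. -/
def nearKernel {d : ℕ} (i : Fin d) (z : Rd d) : ℝ := cutoff d z * rieszKernel i z

/-- The smooth part of the Riesz kernel, equal to it on `|z| ≥ 1/2`. -/
def farKernel {d : ℕ} (i : Fin d) (z : Rd d) : ℝ := (1 - cutoff d z) * rieszKernel i z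

variable {d : ℕ} (i : Fin d)

theorem nearKernel_add_farKernel (z : Rd d) :
    nearKernel i z + farKernel i z = rieszKernel i z := by
  simp only [nearKernel, farKernel]; ring

theorem rieszKernel_neg (z : Rd d) : rieszKernel i (-z) = -rieszKernel i z := by
  simp [rieszKernel, neg_div]

theorem nearKernel_neg (z : Rd d) : nearKernel i (-z) = -nearKernel i z := by
  simp [nearKernel, rieszKernel_neg, (cutoff d).neg]

theorem farKernel_neg (z : Rd d) : farKernel i (-z) = -farKernel i z := by
  simp [farKernel, rieszKernel_neg, (cutoff d).neg]

theorem rieszKernel_smul {r : ℝ} (hr : 0 < r) (z : Rd d) :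
    rieszKernel i (r • z) = (r ^ d)⁻¹ * rieszKernel i z := by
  simp only [rieszKernel, PiLp.smul_apply, smul_eq_mul, norm_smul, Real.norm_of_nonneg hr.le,
    mul_pow]
  rw [pow_succ r]
  field_simp

/-- The weight `‖z‖` is the one with which the kernel meets the increments of a Lipschitz
function. -/
theorem abs_rieszKernel_mul_norm_le (z : Rd d) :
    |rieszKernel i z| * ‖z‖ ≤ ‖z‖ ^ (-((d : ℝ) - 1)) := by
  rcases eq_or_ne z 0 with rfl | hz
  · simp only [norm_zero, mul_zero]; positivity
  have hz' : 0 < ‖z‖ := norm_pos_iff.2 hz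
  have h1 : |z i| ≤ ‖z‖ := by simpa using PiLp.norm_apply_le z i
  have h2 : ‖z‖ ^ (-((d : ℝ) - 1)) = ‖z‖ / ‖z‖ ^ d := by
    rw [neg_sub, Real.rpow_sub hz', Real.rpow_one, Real.rpow_natCast]
  rw [h2, rieszKernel, abs_div, abs_of_pos (pow_pos hz' _), pow_succ, div_mul_eq_mul_div]
  rw [mul_div_mul_right _ _ hz'.ne']
  gcongr

theorem measurable_rieszKernel : Measurable (rieszKernel i) := by
  unfold rieszKernel; fun_prop

theorem measurable_nearKernel : Measurable (nearKernel i) :=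
  (cutoff d).continuous.measurable.mul (measurable_rieszKernel i)

theorem nearKernel_eq_zero {z : Rd d} (hz : 1 / 2 ≤ ‖z‖) : nearKernel i z = 0 := by
  rw [nearKernel, (cutoff d).zero_of_le_dist (by simpa [cutoff] using hz), zero_mul]

theorem farKernel_eq_rieszKernel {z : Rd d} (hz : 1 / 2 ≤ ‖z‖) :
    farKernel i z = rieszKernel i z := by
  rw [farKernel, (cutoff d).zero_of_le_dist (by simpa [cutoff] using hz), sub_zero, one_mul]

theorem abs_nearKernel_le (z : Rd d) : |nearKernel i z| ≤ |rieszKernel i z| := by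
  rw [nearKernel, abs_mul, abs_of_nonneg (cutoff d).nonneg]
  exact mul_le_of_le_one_left (abs_nonneg _) (cutoff d).le_one

/-- The singularity `|z|^{1-d}` is integrable at the origin. -/
theorem integrable_nearKernel_mul_norm :
    Integrable (fun z : Rd d => nearKernel i z * ‖z‖) volume := by
  have : Nontrivial (Rd d) := by
    have : Nonempty (Fin d) := ⟨i⟩
    infer_instance
  have hd : 1 ≤ d := Nat.one_le_iff_ne_zero.2 (fun h => by subst h; exact i.elim0)
  have h1 : IntegrableOn (fun z : Rd d => ‖z‖ ^ (-((d : ℝ) - 1))) (Metric.ball 0 1) volume := by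
    rw [integrableOn_fun_norm_addHaar volume (f := fun r : ℝ => r ^ (-((d : ℝ) - 1)))]
    have : IntegrableOn (fun _ : ℝ => (1 : ℝ)) (Set.Ioo 0 1) volume := by simp
    refine this.congr_fun (fun y hy => ?_) measurableSet_Ioo
    simp only [finrank_euclideanSpace, Fintype.card_fin, smul_eq_mul]
    rw [← Real.rpow_natCast, ← Real.rpow_add hy.1, Nat.cast_sub hd]
    simp
  have h2 := h1.integrable_indicator Metric.isOpen_ball.measurableSet
  refine h2.mono' ((measurable_nearKernel i).mul measurable_norm).aestronglyMeasurable
    (Eventually.of_forall fun z => ?_)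
  rw [norm_mul, norm_norm, Real.norm_eq_abs]
  by_cases hz : z ∈ Metric.ball (0 : Rd d) 1
  · rw [Set.indicator_of_mem hz]
    exact (mul_le_mul_of_nonneg_right (abs_nearKernel_le i z) (norm_nonneg _)).trans
      (abs_rieszKernel_mul_norm_le i z)
  · rw [Set.indicator_of_notMem hz, nearKernel_eq_zero, abs_zero, zero_mul]
    simp only [Metric.mem_ball, dist_zero_right, not_lt] at hz
    linarith

/-- The cutoff equals `1` near the origin, so the singularity of the kernel is removed. -/
theorem contDiff_farKernel {n : ℕ∞} : ContDiff ℝ n (farKernel i) := by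
  rw [contDiff_iff_contDiffAt]
  intro z
  rcases eq_or_ne z 0 with rfl | hz
  · have : farKernel i =ᶠ[𝓝 0] fun _ => 0 := by
      filter_upwards [(cutoff d).eventuallyEq_one] with z hz
      simp [farKernel, hz]
    exact contDiffAt_const.congr_of_eventuallyEq this
  · refine (contDiffAt_const.sub (cutoff d).contDiffAt).mul ?_
    refine ContDiffAt.div ?_ ((contDiffAt_norm ℝ hz).pow _) (by positivity)
    exact (EuclideanSpace.proj (𝕜 := ℝ) i).contDiff.contDiffAt

/-- Outside the unit ball the derivatives of the smooth part of the kernel are controlled by those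
on the unit sphere, by homogeneity. -/
theorem exists_norm_iteratedFDeriv_farKernel_le (k : ℕ) :
    ∃ B, ∀ z, ‖iteratedFDeriv ℝ k (farKernel i) z‖ ≤ B := by
  have hc : Continuous (fun z => ‖iteratedFDeriv ℝ k (farKernel i) z‖) :=
    ((contDiff_farKernel i (n := k)).continuous_iteratedFDeriv' ).norm
  obtain ⟨B, hB⟩ := (isCompact_closedBall (0 : Rd d) 1).exists_bound_of_continuousOn hc.continuousOn
  refine ⟨B, fun z => ?_⟩
  rcases le_total ‖z‖ 1 with hz | hz
  · simpa using hB z (by simpa using hz)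
  set r := ‖z‖ with hr
  have hr0 : 0 < r := by linarith
  set w : Rd d := r⁻¹ • z with hw
  have hzw : z = r • w := by rw [hw, smul_smul, mul_inv_cancel₀ hr0.ne', one_smul]
  have hwn : ‖w‖ = 1 := by
    rw [hw, norm_smul, norm_inv, Real.norm_of_nonneg hr0.le, ← hr, inv_mul_cancel₀ hr0.ne']
  -- near `z` the kernel is a rescaling of its values near the unit vector `w`
  have hev : farKernel i =ᶠ[𝓝 z] (r ^ d)⁻¹ • (farKernel i ∘
      (r⁻¹ • ContinuousLinearMap.id ℝ (Rd d))) := by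
    have h1 : ∀ᶠ u in 𝓝 z, r / 2 < ‖u‖ :=
      (continuous_norm.tendsto z).eventually (lt_mem_nhds (by rw [← hr]; linarith))
    filter_upwards [h1] with u hu
    have hu2 : u = r • (r⁻¹ • u) := by rw [smul_smul, mul_inv_cancel₀ hr0.ne', one_smul]
    have hn : 1 / 2 ≤ ‖r⁻¹ • u‖ := by
      rw [norm_smul, norm_inv, Real.norm_of_nonneg hr0.le]
      rw [inv_mul_eq_div, le_div_iff₀ hr0]; linarith
    rw [farKernel_eq_rieszKernel i (by linarith)]
    simp only [Pi.smul_apply, Function.comp_apply, smul_apply,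
      ContinuousLinearMap.id_apply, smul_eq_mul]
    rw [farKernel_eq_rieszKernel i hn, ← rieszKernel_smul i hr0, ← hu2]
  have hcd : ContDiff ℝ k (farKernel i ∘ (r⁻¹ • ContinuousLinearMap.id ℝ (Rd d))) :=
    (contDiff_farKernel i).comp (r⁻¹ • ContinuousLinearMap.id ℝ (Rd d)).contDiff
  have hmain : ‖iteratedFDeriv ℝ k (farKernel i) z‖ ≤
      (r ^ d)⁻¹ * (‖iteratedFDeriv ℝ k (farKernel i) w‖ * ∏ _j : Fin k, 1) := by
    rw [(hev.iteratedFDeriv ℝ k).eq_of_nhds, iteratedFDeriv_const_smul_apply hcd.contDiffAt,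
      ContinuousLinearMap.iteratedFDeriv_comp_right _ (contDiff_farKernel i (n := k)) z le_rfl,
      norm_smul, Real.norm_of_nonneg (by positivity)]
    gcongr
    refine (ContinuousMultilinearMap.norm_compContinuousLinearMap_le _ _).trans ?_
    simp only [smul_apply, ContinuousLinearMap.id_apply, ← hw]
    gcongr
    rw [norm_smul, norm_inv, Real.norm_of_nonneg hr0.le]
    refine mul_le_one₀ (inv_le_one_of_one_le₀ hz) (norm_nonneg _) ContinuousLinearMap.norm_id_le
  refine hmain.trans ?_
  rw [Finset.prod_const_one, mul_one]
  have h2 := hB w (by simp [hwn])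
  rw [norm_norm] at h2
  refine le_trans (mul_le_of_le_one_left (norm_nonneg _) ?_) h2
  exact inv_le_one_of_one_le₀ (one_le_pow₀ hz)

theorem exists_abs_farKernel_le : ∃ B, ∀ z, |farKernel i z| ≤ B := by
  obtain ⟨B, hB⟩ := exists_norm_iteratedFDeriv_farKernel_le i 0
  exact ⟨B, fun z => by simpa using hB z⟩

end

/-! ### The Riesz transform by absolutely convergent integrals -/

section

variable {d : ℕ} (i : Fin d) {F : Type*} [NormedAddCommGroup F]

/-- Polynomial decay `f(x) = O((1 + |x|)^{-p})`, uniformly on `ℝ^d`. -/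
def Decay (p : ℝ) (f : Rd d → F) : Prop := ∃ C : ℝ, ∀ x, ‖f x‖ ≤ C * (1 + ‖x‖) ^ (-p)

theorem Decay.exists_nonneg {p : ℝ} {f : Rd d → F} (h : Decay p f) :
    ∃ C : ℝ, 0 ≤ C ∧ ∀ x, ‖f x‖ ≤ C * (1 + ‖x‖) ^ (-p) := by
  obtain ⟨C, hC⟩ := h
  refine ⟨C, ?_, hC⟩
  have := (norm_nonneg _).trans (hC 0)
  simpa using this

theorem Decay.mono {p q : ℝ} {f : Rd d → F} (h : Decay p f) (hq : q ≤ p) : Decay q f := by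
  obtain ⟨C, hC0, hC⟩ := h.exists_nonneg
  refine ⟨C, fun x => (hC x).trans ?_⟩
  gcongr
  linarith [norm_nonneg x]

theorem Decay.bounded {p : ℝ} {f : Rd d → F} (h : Decay p f) (hp : 0 ≤ p) :
    ∃ C : ℝ, 0 ≤ C ∧ ∀ x, ‖f x‖ ≤ C := by
  obtain ⟨C, hC0, hC⟩ := (h.mono hp).exists_nonneg
  exact ⟨C, hC0, fun x => by simpa using hC x⟩

theorem Decay.integrable {p : ℝ} {f : Rd d → F} (h : Decay p f) (hp : (d : ℝ) < p)
    (hf : Continuous f) : Integrable f volume := by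
  obtain ⟨C, hC⟩ := h
  exact ((integrable_one_add_norm (by simpa using hp)).const_mul C).mono'
    hf.aestronglyMeasurable (Eventually.of_forall hC)

theorem Decay.add {p : ℝ} {f g : Rd d → F} (hf : Decay p f) (hg : Decay p g) :
    Decay p (fun x => f x + g x) := by
  obtain ⟨C, hC⟩ := hf
  obtain ⟨D, hD⟩ := hg
  refine ⟨C + D, fun x => (norm_add_le _ _).trans ?_⟩
  rw [add_mul]; exact add_le_add (hC x) (hD x)

/-- On a ball of radius `1` of translation parameters, a decaying function is dominated by a
single decaying function. -/
theorem Decay.translate {p : ℝ} (hp : 0 ≤ p) {f : Rd d → F} (h : Decay p f) (x₀ : Rd d) :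
    ∃ C : ℝ, ∀ x ∈ Metric.ball x₀ 1, ∀ z, ‖f (x - z)‖ ≤ C * (1 + ‖z‖) ^ (-p) := by
  obtain ⟨C, hC0, hC⟩ := h.exists_nonneg
  refine ⟨C * (2 + ‖x₀‖) ^ p, fun x hx z => (hC _).trans ?_⟩
  rw [mul_assoc]
  gcongr
  rw [Real.rpow_neg (by positivity), Real.rpow_neg (by positivity), ← div_eq_mul_inv,
    inv_eq_one_div, div_le_div_iff₀ (by positivity) (by positivity), one_mul,
    ← Real.mul_rpow (by positivity) (by positivity)]
  gcongr
  have h1 : ‖z‖ ≤ ‖x‖ + ‖x - z‖ := by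
    have := norm_sub_le x (x - z); simpa using this
  have h2 : ‖x‖ ≤ ‖x₀‖ + 1 := by
    have := norm_le_norm_add_norm_sub' x x₀
    rw [mem_ball_iff_norm] at hx
    linarith
  nlinarith [norm_nonneg x₀, norm_nonneg (x - z), mul_nonneg (norm_nonneg x₀) (norm_nonneg (x - z))]

variable [NormedSpace ℝ F]

theorem Decay.clm_comp {G : Type*} [NormedAddCommGroup G] [NormedSpace ℝ G] (L : F →L[ℝ] G)
    {p : ℝ} {f : Rd d → F} (hf : Decay p f) : Decay p (fun x => L (f x)) := by
  obtain ⟨C, hC⟩ := hf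
  refine ⟨‖L‖ * C, fun x => (L.le_opNorm _).trans ?_⟩
  rw [mul_assoc]; gcongr; exact hC x

/-- `C¹` functions decaying with their first derivative, the derivative one order faster. -/
structure C1Decay (p : ℝ) (f : Rd d → F) : Prop where
  contDiff : ContDiff ℝ 1 f
  decay : Decay p f
  decay_fderiv : Decay (p + 1) (fderiv ℝ f)

theorem norm_sub_le_of_fderiv_le {f : Rd d → F} (hf : ContDiff ℝ 1 f) {G : ℝ}
    (hG : ∀ x, ‖fderiv ℝ f x‖ ≤ G) (x z : Rd d) : ‖f (x - z) - f x‖ ≤ G * ‖z‖ := by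
  have := Convex.norm_image_sub_le_of_norm_fderiv_le (𝕜 := ℝ) (f := f) (s := Set.univ) (x := x)
    (y := x - z) (fun y _ => (hf.differentiable one_ne_zero).differentiableAt) (fun y _ => hG y)
    convex_univ trivial trivial
  simpa using this

theorem C1Decay.exists_lipschitz {p : ℝ} {f : Rd d → F} (hf : C1Decay p f) (hp : 0 ≤ p) :
    ∃ G : ℝ, 0 ≤ G ∧ ∀ x z, ‖f (x - z) - f x‖ ≤ G * ‖z‖ := by
  obtain ⟨G, hG0, hG⟩ := hf.decay_fderiv.bounded (by linarith)
  exact ⟨G, hG0, norm_sub_le_of_fderiv_le hf.contDiff hG⟩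

/-- The contribution of the singular part of the kernel to the Riesz transform. The subtraction of
`f x`, which the oddness of the kernel allows, makes the integral absolutely convergent. -/
def nearRiesz (f : Rd d → F) (x : Rd d) : F := ∫ z, nearKernel i z • (f (x - z) - f x)

/-- The contribution of the smooth part of the kernel to the Riesz transform. -/
def farRiesz (f : Rd d → F) (x : Rd d) : F := ∫ z, farKernel i z • f (x - z)

/-- The Riesz transform, up to its normalizing constant, written with absolutely convergent
integrals. The functions may take values in a normed space, so that the operator can be applied to
derivatives. -/
def absRiesz (f : Rd d → F) (x : Rd d) : F := nearRiesz i f x + farRiesz i f x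

theorem farRiesz_eq (f : Rd d → F) (x : Rd d) :
    farRiesz i f x = ∫ y, farKernel i (x - y) • f y := by
  rw [farRiesz, ← integral_sub_left_eq_self _ volume x]
  simp

theorem norm_nearKernel_smul_le {f : Rd d → F} {G : ℝ}
    (hG : ∀ x z, ‖f (x - z) - f x‖ ≤ G * ‖z‖) (x z : Rd d) :
    ‖nearKernel i z • (f (x - z) - f x)‖ ≤ G * ‖nearKernel i z * ‖z‖‖ := by
  rw [norm_smul, norm_mul, norm_norm, mul_left_comm]
  gcongr
  exact hG x z

theorem continuous_farKernel : Continuous (farKernel i) :=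
  (contDiff_farKernel i (n := 0)).continuous

theorem aestronglyMeasurable_near {f : Rd d → F} (hf : Continuous f) (x : Rd d) :
    AEStronglyMeasurable (fun z => nearKernel i z • (f (x - z) - f x)) volume :=
  (measurable_nearKernel i).aestronglyMeasurable.smul
    (Continuous.aestronglyMeasurable (by fun_prop))

theorem aestronglyMeasurable_far {f : Rd d → F} (hf : Continuous f) (x : Rd d) :
    AEStronglyMeasurable (fun z => farKernel i z • f (x - z)) volume :=
  Continuous.aestronglyMeasurable ((continuous_farKernel i).smul (by fun_prop))

section

variable {p : ℝ} {f : Rd d → F}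

theorem C1Decay.integrable_near (hf : C1Decay p f) (hp : 0 ≤ p) (x : Rd d) :
    Integrable (fun z => nearKernel i z • (f (x - z) - f x)) volume := by
  obtain ⟨G, hG0, hG⟩ := hf.exists_lipschitz hp
  exact ((integrable_nearKernel_mul_norm i).norm.const_mul G).mono'
    (aestronglyMeasurable_near i hf.contDiff.continuous x)
    (Eventually.of_forall (norm_nearKernel_smul_le i hG x))

theorem C1Decay.integrable (hf : C1Decay p f) (hp : (d : ℝ) < p) : Integrable f volume :=
  hf.decay.integrable hp hf.contDiff.continuous

theorem integrable_far (hf : Continuous f) (hfi : Integrable f volume) (x : Rd d) :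
    Integrable (fun z => farKernel i z • f (x - z)) volume := by
  obtain ⟨B, hB⟩ := exists_abs_farKernel_le i
  refine ((hfi.comp_sub_left x).norm.const_mul B).mono' (aestronglyMeasurable_far i hf x)
    (Eventually.of_forall fun z => ?_)
  rw [norm_smul]
  gcongr
  exact hB z

theorem C1Decay.continuous_absRiesz (hf : C1Decay p f) (hp : (d : ℝ) < p) :
    Continuous (absRiesz i f) := by
  have hfc := hf.contDiff.continuous
  have hp0 : 0 ≤ p := (Nat.cast_nonneg d).trans hp.le
  obtain ⟨G, hG0, hG⟩ := hf.exists_lipschitz hp0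
  obtain ⟨B, hB⟩ := exists_abs_farKernel_le i
  refine Continuous.add ?_ ?_
  · refine continuous_of_dominated (fun x => aestronglyMeasurable_near i hfc x)
      (fun x => Eventually.of_forall (norm_nearKernel_smul_le i hG x))
      ((integrable_nearKernel_mul_norm i).norm.const_mul G)
      (Eventually.of_forall fun z => by fun_prop)
  · have : farRiesz i f = fun x => ∫ y, farKernel i (x - y) • f y := funext (farRiesz_eq i f)
    rw [this]
    have hk := continuous_farKernel i
    refine continuous_of_dominated (bound := fun y => B * ‖f y‖)
      (fun x => Continuous.aestronglyMeasurable (by fun_prop))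
      (fun x => Eventually.of_forall fun y => ?_) ((hf.integrable hp).norm.const_mul B)
      (Eventually.of_forall fun z => by fun_prop)
    rw [norm_smul]
    gcongr
    exact hB _

theorem C1Decay.bounded_absRiesz (hf : C1Decay p f) (hp : (d : ℝ) < p) :
    ∃ C : ℝ, ∀ x, ‖absRiesz i f x‖ ≤ C := by
  have hp0 : 0 ≤ p := (Nat.cast_nonneg d).trans hp.le
  obtain ⟨G, hG0, hG⟩ := hf.exists_lipschitz hp0
  obtain ⟨B, hB⟩ := exists_abs_farKernel_le i
  refine ⟨(∫ z : Rd d, G * ‖nearKernel i z * ‖z‖‖) + ∫ y, B * ‖f y‖, fun x => ?_⟩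
  refine (norm_add_le _ _).trans (add_le_add ?_ ?_)
  · exact norm_integral_le_of_norm_le ((integrable_nearKernel_mul_norm i).norm.const_mul G)
      (Eventually.of_forall (norm_nearKernel_smul_le i hG x))
  · rw [farRiesz_eq]
    refine norm_integral_le_of_norm_le ((hf.integrable hp).norm.const_mul B)
      (Eventually.of_forall fun y => ?_)
    rw [norm_smul]
    gcongr
    exact hB _

/-- The Riesz transform commutes with differentiation. -/
theorem C1Decay.hasFDerivAt_absRiesz {q : ℝ} (hf : C1Decay p f) (hp : (d : ℝ) < p)
    (hf' : C1Decay q (fderiv ℝ f)) (hq : (d : ℝ) < q) (x : Rd d) :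
    HasFDerivAt (absRiesz i f) (absRiesz i (fderiv ℝ f) x) x := by
  have hfc := hf.contDiff.continuous
  have hf'c := hf'.contDiff.continuous
  have hp0 : 0 ≤ p := (Nat.cast_nonneg d).trans hp.le
  have hq0 : 0 ≤ q := (Nat.cast_nonneg d).trans hq.le
  have hdf : ∀ y, HasFDerivAt f (fderiv ℝ f y) y := fun y =>
    (hf.contDiff.differentiable one_ne_zero).differentiableAt.hasFDerivAt
  have hsub : ∀ z y, HasFDerivAt (fun x => f (x - z)) (fderiv ℝ f (y - z)) y := fun z y => by
    have := (hdf (y - z)).comp y ((hasFDerivAt_id y).sub_const z)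
    rwa [ContinuousLinearMap.comp_id] at this
  refine HasFDerivAt.add ?_ ?_
  · obtain ⟨G, hG0, hG⟩ := hf'.exists_lipschitz hq0
    refine hasFDerivAt_integral_of_dominated_of_fderiv_le (s := Set.univ) univ_mem
      (Eventually.of_forall fun y => aestronglyMeasurable_near i hfc y)
      (hf.integrable_near i hp0 x) (aestronglyMeasurable_near i hf'c x)
      (Eventually.of_forall fun z y _ => norm_nearKernel_smul_le i hG y z)
      ((integrable_nearKernel_mul_norm i).norm.const_mul G)
      (Eventually.of_forall fun z y _ => ((hsub z y).sub (hdf y)).const_smul _)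
  · obtain ⟨C, hC⟩ := hf'.decay.translate hq0 x
    obtain ⟨B, hB⟩ := exists_abs_farKernel_le i
    have hB0 : 0 ≤ B := (abs_nonneg _).trans (hB 0)
    refine hasFDerivAt_integral_of_dominated_of_fderiv_le (Metric.ball_mem_nhds x one_pos)
      (Eventually.of_forall fun y => aestronglyMeasurable_far i hfc y)
      (integrable_far i hfc (hf.integrable hp) x) (aestronglyMeasurable_far i hf'c x)
      (Eventually.of_forall fun z y hy => ?_)
      (((integrable_one_add_norm (r := q) (by simpa using hq)).const_mul C).const_mul B)
      (Eventually.of_forall fun z y _ => (hsub z y).const_smul _)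
    rw [norm_smul]
    gcongr
    · exact hB z
    · exact hC y hy z

theorem absRiesz_clm_comp [CompleteSpace F] {G : Type*} [NormedAddCommGroup G] [NormedSpace ℝ G]
    [CompleteSpace G] (L : F →L[ℝ] G) (hf : C1Decay p f) (hp : (d : ℝ) < p) (x : Rd d) :
    absRiesz i (fun y => L (f y)) x = L (absRiesz i f x) := by
  have hp0 : 0 ≤ p := (Nat.cast_nonneg d).trans hp.le
  rw [absRiesz, absRiesz, map_add, nearRiesz, nearRiesz, farRiesz, farRiesz,
    ← L.integral_comp_comm (hf.integrable_near i hp0 x),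
    ← L.integral_comp_comm (integrable_far i hf.contDiff.continuous (hf.integrable hp) x)]
  simp

end

end

/-! ### Principal values, dilations and antisymmetry -/

section

variable {d : ℕ} (i : Fin d)

theorem measurableSet_lt_norm (η : ℝ) : MeasurableSet {z : Rd d | η < ‖z‖} :=
  measurableSet_lt measurable_const measurable_norm

/-- The hypothesis `g 0 = 0` only serves to have pointwise convergence of the truncations at every
point. -/
theorem tendsto_setIntegral_lt_norm {g : Rd d → ℝ} (hg : Integrable g volume) (h0 : g 0 = 0) :
    Tendsto (fun η : ℝ => ∫ z in {z : Rd d | η < ‖z‖}, g z) (𝓝[>] 0) (𝓝 (∫ z, g z)) := by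
  simp_rw [← integral_indicator (measurableSet_lt_norm _)]
  refine tendsto_integral_filter_of_dominated_convergence (fun z => ‖g z‖)
    (Eventually.of_forall fun η => (hg.indicator (measurableSet_lt_norm η)).aestronglyMeasurable)
    (Eventually.of_forall fun η => Eventually.of_forall fun z => norm_indicator_le_norm_self _ _)
    hg.norm (Eventually.of_forall fun z => ?_)
  rcases eq_or_ne z 0 with rfl | hz
  · refine tendsto_const_nhds.congr fun η => ?_
    simp only [Set.indicator_apply, h0, ite_self]
  · refine tendsto_const_nhds.congr' ?_
    filter_upwards [nhdsWithin_le_nhds (gt_mem_nhds (norm_pos_iff.2 hz))] with η hη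
    rw [Set.indicator_of_mem (by exact hη)]

theorem indicator_rieszIntegrand (f : Rd d → ℝ) (x : Rd d) (η : ℝ) (y : Rd d) :
    Set.indicator {y : Rd d | η < ‖x - y‖} (rieszIntegrand i f x) y =
      Set.indicator {z : Rd d | η < ‖z‖} (fun z => rieszKernel i z * f (x - z)) (x - y) := by
  simp only [Set.indicator_apply, Set.mem_ofPred_eq, sub_sub_cancel, rieszIntegrand, rieszKernel,
    PiLp.sub_apply, mul_comm]

theorem measurableSet_lt_norm_sub (x : Rd d) (η : ℝ) : MeasurableSet {y : Rd d | η < ‖x - y‖} :=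
  measurableSet_lt measurable_const (by fun_prop)

/-- The truncated integral, as an integral against the kernel. -/
theorem truncRiesz_eq (f : Rd d → ℝ) (x : Rd d) (η : ℝ) :
    truncRiesz i f x η =
      ∫ z, Set.indicator {z : Rd d | η < ‖z‖} (fun z => rieszKernel i z * f (x - z)) z := by
  rw [truncRiesz, ← integral_indicator (measurableSet_lt_norm_sub x η)]
  simp_rw [indicator_rieszIntegrand]
  exact integral_sub_left_eq_self _ volume x

theorem integrableOn_nearKernel {η : ℝ} (hη : 0 < η) :
    IntegrableOn (nearKernel i) {z : Rd d | η < ‖z‖} volume := by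
  refine Integrable.mono' ((integrable_nearKernel_mul_norm i).norm.const_mul η⁻¹).integrableOn
    (measurable_nearKernel i).aestronglyMeasurable
    ((ae_restrict_iff' (measurableSet_lt_norm η)).2 (Eventually.of_forall fun z hz => ?_))
  have hz : η < ‖z‖ := hz
  rw [norm_mul, norm_norm, ← div_eq_inv_mul, le_div_iff₀ hη]
  gcongr

theorem setIntegral_nearKernel (η : ℝ) : ∫ z in {z : Rd d | η < ‖z‖}, nearKernel i z = 0 := by
  rw [← integral_indicator (measurableSet_lt_norm _)]
  have h := integral_neg_eq_self
    (Set.indicator {z : Rd d | η < ‖z‖} (nearKernel i)) (volume : Measure (Rd d))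
  have h2 : (fun z => Set.indicator {z : Rd d | η < ‖z‖} (nearKernel i) (-z)) =
      fun z => -Set.indicator {z : Rd d | η < ‖z‖} (nearKernel i) z := by
    ext z
    simp only [Set.indicator_apply, Set.mem_ofPred_eq, norm_neg, nearKernel_neg]
    split_ifs <;> simp
  rw [h2, integral_neg] at h
  linarith

section

variable {p : ℝ} {f : Rd d → ℝ}

/-- The principal value defining the Riesz transform exists, and is given by the absolutely
convergent integrals of `absRiesz`: the constant `f x` may be subtracted over the support of the
even cutoff because the truncated kernel is odd. -/
theorem C1Decay.tendsto_truncRiesz (hf : C1Decay p f) (hp : (d : ℝ) < p) (x : Rd d) :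
    (∀ η : ℝ, 0 < η →
      IntegrableOn (rieszIntegrand i f x) {y : Rd d | η < ‖x - y‖} volume) ∧
    Tendsto (truncRiesz i f x) (𝓝[>] 0) (𝓝 (absRiesz i f x)) := by
  have hp0 : 0 ≤ p := (Nat.cast_nonneg d).trans hp.le
  have h1 := hf.integrable_near i hp0 x
  have h3 := integrable_far i hf.contDiff.continuous (hf.integrable hp) x
  have hsplit : (fun z => rieszKernel i z * f (x - z)) = fun z =>
      (nearKernel i z • (f (x - z) - f x) + farKernel i z • f (x - z)) + nearKernel i z * f x := by
    ext z
    rw [← nearKernel_add_farKernel]; simp only [smul_eq_mul]; ring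
  have hint : ∀ η : ℝ, 0 < η →
      IntegrableOn (fun z => rieszKernel i z * f (x - z)) {z : Rd d | η < ‖z‖} volume := by
    intro η hη
    rw [hsplit]
    exact (h1.add h3).integrableOn.add ((integrableOn_nearKernel i hη).mul_const _)
  constructor
  · intro η hη
    rw [← integrable_indicator_iff (measurableSet_lt_norm_sub x η)]
    have := ((integrable_indicator_iff (measurableSet_lt_norm η)).2 (hint η hη)).comp_sub_left x
    refine this.congr (Eventually.of_forall fun y => ?_)
    exact (indicator_rieszIntegrand i f x η y).symm
  · have hlim := tendsto_setIntegral_lt_norm (h1.add h3) (by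
      simp [nearKernel, farKernel, rieszKernel])
    have e : ∫ z, (((fun z => nearKernel i z • (f (x - z) - f x)) +
        fun z => farKernel i z • f (x - z)) : Rd d → ℝ) z = absRiesz i f x := integral_add h1 h3
    rw [e] at hlim
    refine hlim.congr' ?_
    filter_upwards [self_mem_nhdsWithin] with η hη
    have e2 := integral_add (h1.add h3).integrableOn
      ((integrableOn_nearKernel i hη).mul_const (f x))
    rw [integral_mul_const, setIntegral_nearKernel, zero_mul, add_zero] at e2
    rw [truncRiesz_eq, integral_indicator (measurableSet_lt_norm η), hsplit, ← e2]
    rfl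

theorem C1Decay.rieszExistsAt (hf : C1Decay p f) (hp : (d : ℝ) < p) (x : Rd d) :
    RieszExistsAt i f x :=
  ⟨(hf.tendsto_truncRiesz i hp x).1, _, (hf.tendsto_truncRiesz i hp x).2⟩

theorem C1Decay.riesz_eq (hf : C1Decay p f) (hp : (d : ℝ) < p) (x : Rd d) :
    riesz i f x = rieszConst d * absRiesz i f x := by
  rw [riesz, (hf.tendsto_truncRiesz i hp x).2.limUnder_eq]

theorem truncRiesz_comp_smul (f : Rd d → ℝ) {r : ℝ} (hr : 0 < r) (x : Rd d) (η : ℝ) :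
    truncRiesz i (fun y => f (r • y)) x η = truncRiesz i f (r • x) (r * η) := by
  rw [truncRiesz_eq, truncRiesz_eq]
  have h := Measure.integral_comp_smul (volume : Measure (Rd d)) (fun z : Rd d =>
    Set.indicator {z : Rd d | r * η < ‖z‖} (fun z => rieszKernel i z * f (r • x - z)) z) r
  have h2 : ∀ z : Rd d,
      Set.indicator {z : Rd d | r * η < ‖z‖} (fun z => rieszKernel i z * f (r • x - z)) (r • z) =
      (r ^ d)⁻¹ *
        Set.indicator {z : Rd d | η < ‖z‖} (fun z => rieszKernel i z * f (r • (x - z))) z := by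
    intro z
    simp only [Set.indicator_apply, Set.mem_ofPred_eq, norm_smul, Real.norm_of_nonneg hr.le,
      mul_lt_mul_iff_right₀ hr, rieszKernel_smul i hr, smul_sub]
    split_ifs <;> ring
  simp_rw [h2] at h
  rw [integral_const_mul] at h
  have hpos : 0 < (r ^ d)⁻¹ := by positivity
  rw [finrank_euclideanSpace, Fintype.card_fin, abs_of_pos hpos, smul_eq_mul] at h
  exact mul_left_cancel₀ hpos.ne' h

/-- The Riesz transform commutes with dilations. -/
theorem C1Decay.absRiesz_comp_smul (hf : C1Decay p f) (hp : (d : ℝ) < p) {r : ℝ} (hr : 0 < r)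
    (hfr : C1Decay p (fun y => f (r • y))) (x : Rd d) :
    absRiesz i (fun y => f (r • y)) x = absRiesz i f (r • x) := by
  have h1 := (hfr.tendsto_truncRiesz i hp x).2
  have h2 := (hf.tendsto_truncRiesz i hp (r • x)).2
  have h3 : Tendsto (fun η : ℝ => r * η) (𝓝[>] 0) (𝓝[>] 0) := by
    refine tendsto_nhdsWithin_iff.2 ⟨?_, ?_⟩
    · have : Tendsto (fun η : ℝ => r * η) (𝓝 0) (𝓝 (r * 0)) := by
        exact (continuous_const.mul continuous_id).tendsto 0
      rw [mul_zero] at this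
      exact this.mono_left nhdsWithin_le_nhds
    · filter_upwards [self_mem_nhdsWithin] with η hη
      exact mul_pos hr hη
  refine tendsto_nhds_unique h1 ((h2.comp h3).congr fun η => ?_)
  rw [truncRiesz_comp_smul i f hr]; rfl

/-- The decay rates are kept by a dilation, but the constants depend on `r`. -/
theorem C1Decay.comp_smul (hf : C1Decay p f) (hp : 0 ≤ p) {r : ℝ} (hr : 0 < r) :
    C1Decay p (fun y => f (r • y)) := by
  have key : ∀ q : ℝ, 0 ≤ q → ∃ D : ℝ, 0 ≤ D ∧
      ∀ x : Rd d, (1 + ‖r • x‖) ^ (-q) ≤ D * (1 + ‖x‖) ^ (-q) := by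
    intro q hq
    set m := min r 1 with hm
    have hm0 : 0 < m := lt_min hr one_pos
    refine ⟨m ^ (-q), by positivity, fun x => ?_⟩
    rw [← Real.mul_rpow hm0.le (by positivity)]
    refine Real.rpow_le_rpow_of_nonpos (by positivity) ?_ (by linarith)
    rw [norm_smul, Real.norm_of_nonneg hr.le, mul_add, mul_one]
    gcongr
    · exact min_le_right _ _
    · exact min_le_left _ _
  have hder : ∀ x, fderiv ℝ (fun y => f (r • y)) x = r • fderiv ℝ f (r • x) := fun x =>
    fderiv_comp_smul ..
  refine ⟨hf.contDiff.comp (contDiff_const_smul r), ?_, ?_⟩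
  · obtain ⟨C, hC0, hC⟩ := hf.decay.exists_nonneg
    obtain ⟨D, hD0, hD⟩ := key p hp
    refine ⟨C * D, fun x => (hC _).trans ?_⟩
    rw [mul_assoc]; gcongr; exact hD x
  · obtain ⟨C, hC0, hC⟩ := hf.decay_fderiv.exists_nonneg
    obtain ⟨D, hD0, hD⟩ := key (p + 1) (by linarith)
    refine ⟨r * (C * D), fun x => ?_⟩
    rw [hder, norm_smul, Real.norm_of_nonneg hr.le, mul_assoc, mul_assoc]
    gcongr
    refine (hC _).trans ?_
    gcongr; exact hD x

end

/-- The Riesz transform is antisymmetric. -/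
theorem integral_mul_absRiesz {p : ℝ} {f g : Rd d → ℝ} (hf : C1Decay p f) (hg : C1Decay p g)
    (hp : (d : ℝ) < p) : ∫ x, g x * absRiesz i f x = -∫ x, f x * absRiesz i g x := by
  have hp0 : 0 ≤ p := (Nat.cast_nonneg d).trans hp.le
  -- the two parts of the kernel are treated separately, with Fubini's theorem
  have near_int : ∀ {f g : Rd d → ℝ}, C1Decay p f → C1Decay p g →
      Integrable (fun q : Rd d × Rd d => g q.1 * (nearKernel i q.2 * (f (q.1 - q.2) - f q.1)))
        (volume.prod volume) := by
    intro f g hf hg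
    obtain ⟨G, hG0, hG⟩ := hf.exists_lipschitz hp0
    have hfc := hf.contDiff.continuous
    have hgc := hg.contDiff.continuous
    have hm := measurable_nearKernel i
    refine (((hg.integrable hp).norm).mul_prod
      ((integrable_nearKernel_mul_norm i).norm.const_mul G)).mono'
      (Measurable.aestronglyMeasurable (by fun_prop)) (Eventually.of_forall fun q => ?_)
    rw [norm_mul]
    gcongr
    exact norm_nearKernel_smul_le i hG q.1 q.2
  have far_int : ∀ {f g : Rd d → ℝ}, C1Decay p f → C1Decay p g →
      Integrable (fun q : Rd d × Rd d => g q.1 * (farKernel i (q.1 - q.2) * f q.2))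
        (volume.prod volume) := by
    intro f g hf hg
    obtain ⟨B, hB⟩ := exists_abs_farKernel_le i
    have hfc := hf.contDiff.continuous
    have hgc := hg.contDiff.continuous
    have hk := continuous_farKernel i
    refine (((hg.integrable hp).norm).mul_prod ((hf.integrable hp).norm.const_mul B)).mono'
      (Continuous.aestronglyMeasurable (by fun_prop)) (Eventually.of_forall fun q => ?_)
    rw [norm_mul, norm_mul]
    gcongr
    exact hB _
  -- after Fubini, a translation moves the increment from `f` to `g`, with `z` replaced by `-z`
  have near_eq : ∀ {f g : Rd d → ℝ}, C1Decay p f → C1Decay p g →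
      ∫ x, g x * nearRiesz i f x =
        ∫ z, nearKernel i z * ∫ x, g x * (f (x - z) - f x) := by
    intro f g hf hg
    have h := integral_integral_swap (f := fun x z => g x * (nearKernel i z * (f (x - z) - f x)))
      (near_int hf hg)
    simp only [nearRiesz, smul_eq_mul, ← integral_const_mul]
    rw [h]
    refine integral_congr_ae (Eventually.of_forall fun z =>
      integral_congr_ae (Eventually.of_forall fun x => ?_))
    simp only; ring
  have bdd_int : ∀ {f g : Rd d → ℝ}, C1Decay p f → C1Decay p g → ∀ z : Rd d,
      Integrable (fun x => g x * f (x - z)) volume := by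
    intro f g hf hg z
    obtain ⟨C, hC0, hC⟩ := hf.decay.bounded hp0
    have hfc := hf.contDiff.continuous
    exact (hg.integrable hp).mul_bdd (c := C)
      (Continuous.aestronglyMeasurable (by fun_prop)) (Eventually.of_forall fun x => hC _)
  have inner_eq : ∀ z : Rd d, ∫ x, g x * (f (x - z) - f x) = ∫ x, f x * (g (x - -z) - g x) := by
    intro z
    have a := bdd_int hf hg z
    have a0 := bdd_int hf hg 0
    have b := bdd_int hg hf (-z)
    have b0 := bdd_int hg hf 0
    simp only [sub_zero] at a0 b0
    simp only [mul_sub]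
    rw [integral_sub a a0, integral_sub b b0]
    have e := integral_sub_right_eq_self (μ := (volume : Measure (Rd d)))
      (fun x => f x * g (x - -z)) z
    simp only [sub_neg_eq_add, sub_add_cancel] at e ⊢
    rw [← e]
    simp only [mul_comm]
  have near : ∫ x, g x * nearRiesz i f x = -∫ x, f x * nearRiesz i g x := by
    rw [near_eq hf hg, near_eq hg hf, ← integral_neg_eq_self, ← integral_neg]
    refine integral_congr_ae (Eventually.of_forall fun z => ?_)
    simp only
    rw [inner_eq, nearKernel_neg, neg_neg, neg_mul]
  have far : ∫ x, g x * farRiesz i f x = -∫ x, f x * farRiesz i g x := by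
    have h := integral_integral_swap (f := fun x y => g x * (farKernel i (x - y) * f y))
      (far_int hf hg)
    simp only [farRiesz_eq, smul_eq_mul, ← integral_const_mul]
    rw [h, ← integral_neg]
    refine integral_congr_ae (Eventually.of_forall fun y => ?_)
    simp only
    rw [← integral_neg]
    refine integral_congr_ae (Eventually.of_forall fun x => ?_)
    simp only
    rw [← neg_sub y x, farKernel_neg]; ring
  have i1 : ∀ {f g : Rd d → ℝ}, C1Decay p f → C1Decay p g →
      Integrable (fun x => g x * nearRiesz i f x) volume := by
    intro f g hf hg
    have := (near_int hf hg).integral_prod_left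
    simpa only [integral_const_mul, nearRiesz, smul_eq_mul] using this
  have i2 : ∀ {f g : Rd d → ℝ}, C1Decay p f → C1Decay p g →
      Integrable (fun x => g x * farRiesz i f x) volume := by
    intro f g hf hg
    have := (far_int hf hg).integral_prod_left
    simpa only [integral_const_mul, farRiesz_eq, smul_eq_mul] using this
  simp only [absRiesz, mul_add]
  rw [integral_add (i1 hf hg) (i2 hf hg), integral_add (i1 hg hf) (i2 hg hf), near, far]
  ring

end

/-! ### Taylor remainders and vanishing moments -/

section

variable {d : ℕ}

/-- All moments of `f` of order less than `N` vanish. -/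
def MomentsVanish (N : ℕ) (f : Rd d → ℝ) : Prop :=
  ∀ β : Fin d → ℕ, order β < N → ∫ x : Rd d, monomial β x * f x = 0

theorem abs_monomial_le (β : Fin d → ℕ) (x : Rd d) : |monomial β x| ≤ ‖x‖ ^ order β := by
  rw [monomial, Finset.abs_prod, order, ← Finset.prod_pow_eq_pow_sum]
  refine Finset.prod_le_prod (fun _ _ => abs_nonneg _) fun j _ => ?_
  rw [abs_pow]
  gcongr
  simpa using PiLp.norm_apply_le x j

theorem continuous_monomial (β : Fin d → ℕ) : Continuous (monomial β) := by
  unfold monomial; fun_prop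

theorem Decay.integrable_mul_rpow {p q : ℝ} {f : Rd d → ℝ} (hf : Decay p f) (hfc : Continuous f)
    (hq : 0 ≤ q) (hpq : (d : ℝ) + q < p) : Integrable (fun x => |f x| * ‖x‖ ^ q) volume := by
  obtain ⟨C, hC0, hC⟩ := hf.exists_nonneg
  refine ((integrable_one_add_norm (r := p - q) (by simp; linarith)).const_mul C).mono'
    (hfc.abs.mul (continuous_norm.rpow_const fun x => Or.inr hq)).aestronglyMeasurable
    (Eventually.of_forall fun x => ?_)
  have h1 : (1 + ‖x‖) ^ (-(p - q)) = (1 + ‖x‖) ^ (-p) * (1 + ‖x‖) ^ q := by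
    rw [← Real.rpow_add (by positivity)]; congr 1; ring
  rw [norm_mul, Real.norm_of_nonneg (abs_nonneg _), Real.norm_of_nonneg (by positivity), h1,
    ← mul_assoc]
  gcongr
  · exact hC x
  · linarith [norm_nonneg x]

theorem Decay.integrable_monomial_mul {p : ℝ} {f : Rd d → ℝ} (hf : Decay p f)
    (hfc : Continuous f) {β : Fin d → ℕ} (hβ : (d : ℝ) + order β < p) :
    Integrable (fun x => monomial β x * f x) volume := by
  refine (hf.integrable_mul_rpow hfc (Nat.cast_nonneg (order β)) hβ).mono'
    ((continuous_monomial β).mul hfc).aestronglyMeasurable (Eventually.of_forall fun x => ?_)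
  rw [norm_mul, mul_comm, Real.rpow_natCast]
  gcongr
  · exact le_rfl
  · exact abs_monomial_le β x

/-- A homogeneous polynomial, given by a multilinear map on the diagonal, is a linear combination
of monomials of the same degree. -/
theorem multilinear_diag_eq {k : ℕ} (T : ContinuousMultilinearMap ℝ (fun _ : Fin k => Rd d) ℝ)
    (u : Rd d) : T (fun _ => u) = ∑ j : Fin k → Fin d,
      monomial (fun a => (Finset.univ.filter fun l => j l = a).card) u *
        T (fun l => EuclideanSpace.single (j l) 1) := by
  have hu : u = ∑ a, u a • EuclideanSpace.single a (1 : ℝ) := by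
    have := (EuclideanSpace.basisFun (Fin d) ℝ).sum_repr u
    simpa using this.symm
  conv_lhs => rw [hu]
  rw [T.map_sum]
  refine Finset.sum_congr rfl fun j _ => ?_
  rw [T.map_smul_univ, smul_eq_mul]
  congr 1
  rw [monomial, ← Finset.prod_fiberwise' Finset.univ j (fun a => u a)]
  refine Finset.prod_congr rfl fun a _ => ?_
  rw [Finset.prod_const]

theorem order_card_fiber {k : ℕ} (j : Fin k → Fin d) :
    order (fun a => (Finset.univ.filter fun l => j l = a).card) = k := by
  rw [order, ← Finset.card_eq_sum_card_fiberwise (fun _ _ => Finset.mem_univ _)]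
  simp

section

variable {N : ℕ} {p : ℝ} {f : Rd d → ℝ}

theorem integrable_mul_multilinear (hf : Decay p f) (hfc : Continuous f) {k : ℕ}
    (hk : (d : ℝ) + k < p) (T : ContinuousMultilinearMap ℝ (fun _ : Fin k => Rd d) ℝ) :
    Integrable (fun x => f x * T (fun _ => x)) volume := by
  simp only [multilinear_diag_eq T, Finset.mul_sum]
  refine integrable_finsetSum _ fun j _ => ?_
  have := (hf.integrable_monomial_mul hfc (β := fun a => (Finset.univ.filter fun l => j l = a).card)
    (by rw [order_card_fiber]; exact hk)).mul_const (T (fun l => EuclideanSpace.single (j l) 1))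
  refine this.congr (Eventually.of_forall fun x => ?_)
  simp only; ring

theorem MomentsVanish.integral_mul_multilinear (hm : MomentsVanish N f) (hf : Decay p f)
    (hfc : Continuous f) {k : ℕ} (hk : (d : ℝ) + k < p) (hkN : k < N)
    (T : ContinuousMultilinearMap ℝ (fun _ : Fin k => Rd d) ℝ) :
    ∫ x, f x * T (fun _ => x) = 0 := by
  have h : ∀ x, f x * T (fun _ => x) = ∑ j : Fin k → Fin d,
      (monomial (fun a => (Finset.univ.filter fun l => j l = a).card) x * f x) *
        T (fun l => EuclideanSpace.single (j l) 1) := by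
    intro x
    rw [multilinear_diag_eq T, Finset.mul_sum]
    exact Finset.sum_congr rfl fun j _ => by ring
  simp only [h]
  rw [integral_finsetSum]
  · refine Finset.sum_eq_zero fun j _ => ?_
    rw [integral_mul_const, hm _ (by rw [order_card_fiber]; exact hkN), zero_mul]
  · intro j _
    exact (hf.integrable_monomial_mul hfc (by rw [order_card_fiber]; exact hk)).mul_const _

/-- The Taylor polynomial of degree `N - 1` at `0`. -/
def taylorPoly (N : ℕ) (H : Rd d → ℝ) (u : Rd d) : ℝ :=
  ∑ k ∈ Finset.range N, ((k.factorial : ℝ))⁻¹ * iteratedFDeriv ℝ k H 0 (fun _ => u)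

/-- Interpolation between the bounds `|u|^N` for small `u` and `|u|^{N-1}` for large `u` of the
remainder in Taylor's formula. -/
theorem abs_sub_taylorPoly_le {n : ℕ} {H : Rd d → ℝ} (hH : ContDiff ℝ (n + 1) H) {B : ℝ}
    (hB : ∀ k ≤ n + 1, ∀ z, ‖iteratedFDeriv ℝ k H z‖ ≤ B) {δ : ℝ} (hδ0 : 0 ≤ δ) (hδ1 : δ ≤ 1)
    (u : Rd d) : |H u - taylorPoly (n + 1) H u| ≤ (n + 2) * B * ‖u‖ ^ ((n : ℝ) + δ) := by
  have hB0 : 0 ≤ B := (norm_nonneg _).trans (hB 0 (by lia) 0)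
  rcases le_total ‖u‖ 1 with hu | hu
  · have ht := map_add_eq_sum_add_integral_iteratedFDeriv (f := H) (n := n) (x := 0) (y := u)
      (fun t _ => hH.contDiffAt)
    rw [zero_add] at ht
    have hrem : |H u - taylorPoly (n + 1) H u| ≤ B * ‖u‖ ^ (n + 1) := by
      have h1 : H u - taylorPoly (n + 1) H u = ((n.factorial : ℝ))⁻¹ *
          ∫ t in (0 : ℝ)..1, (1 - t) ^ n * iteratedFDeriv ℝ (n + 1) H (t • u) (fun _ => u) := by
        rw [ht, taylorPoly]
        simp only [smul_eq_mul, zero_add, add_sub_cancel_left]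
      have h2 : ‖∫ t in (0 : ℝ)..1, (1 - t) ^ n *
          iteratedFDeriv ℝ (n + 1) H (t • u) (fun _ => u)‖ ≤ (B * ‖u‖ ^ (n + 1)) * |1 - 0| := by
        refine intervalIntegral.norm_integral_le_of_norm_le_const fun t ht => ?_
        rw [Set.uIoc_of_le zero_le_one] at ht
        have h3 : ‖(1 - t) ^ n‖ ≤ 1 := by
          rw [norm_pow, Real.norm_of_nonneg (by linarith [ht.2])]
          exact pow_le_one₀ (by linarith [ht.2]) (by linarith [ht.1])
        have h4 : ‖iteratedFDeriv ℝ (n + 1) H (t • u) (fun _ => u)‖ ≤ B * ‖u‖ ^ (n + 1) := by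
          refine (ContinuousMultilinearMap.le_opNorm _ _).trans ?_
          rw [Finset.prod_const, Finset.card_univ, Fintype.card_fin]
          gcongr
          exact hB _ le_rfl _
        rw [norm_mul]
        exact (mul_le_mul h3 h4 (norm_nonneg _) zero_le_one).trans_eq (one_mul _)
      rw [h1, abs_mul]
      rw [sub_zero, abs_one, mul_one] at h2
      have h5 : |((n.factorial : ℝ))⁻¹| ≤ 1 := by
        rw [abs_of_nonneg (by positivity)]
        exact inv_le_one_of_one_le₀ (by exact_mod_cast n.factorial_pos)
      exact (mul_le_mul h5 h2 (abs_nonneg _) zero_le_one).trans_eq (one_mul _)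
    refine hrem.trans ?_
    have h6 : ‖u‖ ^ (n + 1) ≤ ‖u‖ ^ ((n : ℝ) + δ) := by
      rcases eq_or_ne u 0 with rfl | hu0
      · rw [norm_zero, zero_pow (by lia)]; positivity
      rw [← Real.rpow_natCast]
      refine Real.rpow_le_rpow_of_exponent_ge (norm_pos_iff.2 hu0) hu ?_
      push_cast; linarith
    have h7 : B ≤ (n + 2) * B := by nlinarith [(Nat.cast_nonneg n : (0 : ℝ) ≤ n)]
    gcongr
  · have h1 : |H u| ≤ B := by simpa using hB 0 (by lia) u
    have h2 : |taylorPoly (n + 1) H u| ≤ ((n : ℝ) + 1) * (B * ‖u‖ ^ n) := by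
      rw [taylorPoly]
      refine (Finset.abs_sum_le_sum_abs _ _).trans ?_
      refine (Finset.sum_le_card_nsmul _ _ (B * ‖u‖ ^ n) fun k hk => ?_).trans_eq (by simp)
      have hk' : k ≤ n := by simpa [Nat.lt_succ_iff] using hk
      have h5 : |((k.factorial : ℝ))⁻¹| ≤ 1 := by
        rw [abs_of_nonneg (by positivity)]
        exact inv_le_one_of_one_le₀ (by exact_mod_cast k.factorial_pos)
      have h6 : ‖iteratedFDeriv ℝ k H 0 (fun _ => u)‖ ≤ B * ‖u‖ ^ n := by
        refine (ContinuousMultilinearMap.le_opNorm _ _).trans ?_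
        rw [Finset.prod_const, Finset.card_univ, Fintype.card_fin]
        gcongr
        exact hB _ (by lia) _
      rw [abs_mul]
      exact (mul_le_mul h5 h6 (abs_nonneg _) zero_le_one).trans_eq (one_mul _)
    have h3 : ‖u‖ ^ n ≤ ‖u‖ ^ ((n : ℝ) + δ) := by
      rw [← Real.rpow_natCast]
      exact Real.rpow_le_rpow_of_exponent_le hu (by linarith)
    have h4 : (1 : ℝ) ≤ ‖u‖ ^ ((n : ℝ) + δ) := Real.one_le_rpow hu (by positivity)
    calc |H u - taylorPoly (n + 1) H u| ≤ |H u| + |taylorPoly (n + 1) H u| := abs_sub _ _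
      _ ≤ B * 1 + ((n : ℝ) + 1) * (B * ‖u‖ ^ n) := by linarith
      _ ≤ B * ‖u‖ ^ ((n : ℝ) + δ) + ((n : ℝ) + 1) * (B * ‖u‖ ^ ((n : ℝ) + δ)) := by gcongr
      _ = _ := by ring

theorem integral_comp_smul_mul {r : ℝ} (hr : 0 < r) (G : Rd d → ℝ) :
    ∫ u, G (r • u) = (r ^ d)⁻¹ * ∫ u, G u := by
  rw [Measure.integral_comp_smul, finrank_euclideanSpace, Fintype.card_fin,
    abs_of_pos (by positivity), smul_eq_mul]

/-- Pairing a dilated function with vanishing moments against a smooth function: only the Taylor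
remainder of the latter contributes, which gains a power of the dilation parameter. -/
theorem MomentsVanish.exists_abs_integral_comp_smul_mul_le {n : ℕ} (hm : MomentsVanish (n + 1) f)
    (hf : Decay p f) (hfc : Continuous f) {δ : ℝ} (hδ0 : 0 ≤ δ) (hδ1 : δ ≤ 1)
    (hp : (d : ℝ) + (n + δ) < p) :
    ∃ C : ℝ, 0 ≤ C ∧ ∀ (H : Rd d → ℝ) (B : ℝ), ContDiff ℝ (n + 1) H →
      (∀ k ≤ n + 1, ∀ z, ‖iteratedFDeriv ℝ k H z‖ ≤ B) → ∀ r : ℝ, 0 < r →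
      |∫ u, f (r • u) * H u| ≤ C * B * r ^ (-((d : ℝ) + (n + δ))) := by
  have hq0 : 0 ≤ (n : ℝ) + δ := by positivity
  have hint := hf.integrable_mul_rpow hfc hq0 hp
  refine ⟨(n + 2) * ∫ x, |f x| * ‖x‖ ^ ((n : ℝ) + δ), ?_, fun H B hH hB r hr => ?_⟩
  · have : 0 ≤ ∫ x, |f x| * ‖x‖ ^ ((n : ℝ) + δ) :=
      integral_nonneg fun x => by positivity
    positivity
  have hB0 : 0 ≤ B := (norm_nonneg _).trans (hB 0 (by lia) 0)
  have hkp : ∀ k ∈ Finset.range (n + 1), (d : ℝ) + k < p := fun k hk => by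
    have : (k : ℝ) ≤ n := by exact_mod_cast Nat.lt_succ_iff.1 (Finset.mem_range.1 hk)
    linarith
  -- a multilinear map on the diagonal is homogeneous
  have hhom : ∀ (k : ℕ) (u : Rd d), iteratedFDeriv ℝ k H 0 (fun _ => u) =
      (r ^ k)⁻¹ * iteratedFDeriv ℝ k H 0 (fun _ => r • u) := by
    intro k u
    rw [ContinuousMultilinearMap.map_smul_univ _ (fun _ => r) (fun _ => u)]
    simp only [Finset.prod_const, Finset.card_univ, Fintype.card_fin, smul_eq_mul]
    rw [inv_mul_cancel_left₀ (pow_pos hr k).ne']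
  have hterm : ∀ (k : ℕ) (u : Rd d),
      f (r • u) * (((k.factorial : ℝ))⁻¹ * iteratedFDeriv ℝ k H 0 (fun _ => u)) =
      (((k.factorial : ℝ))⁻¹ * (r ^ k)⁻¹) *
        ((fun x => f x * iteratedFDeriv ℝ k H 0 (fun _ => x)) (r • u)) := by
    intro k u
    rw [hhom]; ring
  have hPint : ∀ k ∈ Finset.range (n + 1), Integrable (fun u =>
      f (r • u) * (((k.factorial : ℝ))⁻¹ * iteratedFDeriv ℝ k H 0 (fun _ => u))) volume := by
    intro k hk
    simp only [hterm]
    exact ((integrable_mul_multilinear hf hfc (hkp k hk) _).comp_smul hr.ne').const_mul _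
  have hP0 : ∫ u, f (r • u) * taylorPoly (n + 1) H u = 0 := by
    simp only [taylorPoly, Finset.mul_sum]
    rw [integral_finsetSum _ hPint]
    refine Finset.sum_eq_zero fun k hk => ?_
    simp only [hterm]
    rw [integral_const_mul,
      integral_comp_smul_mul hr (fun x => f x * iteratedFDeriv ℝ k H 0 (fun _ => x)),
      hm.integral_mul_multilinear hf hfc (hkp k hk) (Finset.mem_range.1 hk), mul_zero, mul_zero]
  have hPi : Integrable (fun u => f (r • u) * taylorPoly (n + 1) H u) volume := by
    simp only [taylorPoly, Finset.mul_sum]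
    exact integrable_finsetSum _ hPint
  have hHi : Integrable (fun u => f (r • u) * H u) volume := by
    have hfi := (hf.integrable (by linarith) hfc).comp_smul hr.ne'
    refine hfi.mul_bdd (c := B) hH.continuous.aestronglyMeasurable
      (Eventually.of_forall fun u => ?_)
    simpa using hB 0 (by lia) u
  have hsub : ∫ u, f (r • u) * H u = ∫ u, f (r • u) * (H u - taylorPoly (n + 1) H u) := by
    simp only [mul_sub]
    rw [integral_sub hHi hPi, hP0, sub_zero]
  rw [hsub]
  have hdom : ∀ u : Rd d, ‖f (r • u) * (H u - taylorPoly (n + 1) H u)‖ ≤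
      ((n + 2) * B * r ^ (-((n : ℝ) + δ))) *
        ((fun x => |f x| * ‖x‖ ^ ((n : ℝ) + δ)) (r • u)) := by
    intro u
    have h1 := abs_sub_taylorPoly_le hH hB hδ0 hδ1 u
    have h2 : ‖u‖ ^ ((n : ℝ) + δ) = r ^ (-((n : ℝ) + δ)) * ‖r • u‖ ^ ((n : ℝ) + δ) := by
      rw [norm_smul, Real.norm_of_nonneg hr.le, Real.mul_rpow hr.le (norm_nonneg _), ← mul_assoc,
        ← Real.rpow_add hr, neg_add_cancel, Real.rpow_zero, one_mul]
    rw [h2] at h1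
    rw [norm_mul, Real.norm_eq_abs, Real.norm_eq_abs]
    calc |f (r • u)| * |H u - taylorPoly (n + 1) H u| ≤ |f (r • u)| *
          ((n + 2) * B * (r ^ (-((n : ℝ) + δ)) * ‖r • u‖ ^ ((n : ℝ) + δ))) := by gcongr
      _ = _ := by ring
  refine (norm_integral_le_of_norm_le ((hint.comp_smul hr.ne').const_mul _)
    (Eventually.of_forall hdom)).trans_eq ?_
  rw [integral_const_mul, integral_comp_smul_mul hr (fun x => |f x| * ‖x‖ ^ ((n : ℝ) + δ)),
    neg_add (d : ℝ), Real.rpow_add hr, Real.rpow_neg hr.le (d : ℝ), Real.rpow_natCast]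
  ring

end

end

/-! ### Decay and vanishing moments of a Riesz transform -/

section

variable {d : ℕ} (i : Fin d)

section

variable {F : Type*} [NormedAddCommGroup F] [NormedSpace ℝ F]

theorem decay_of_hasCompactSupport {g : Rd d → F} (hg : Continuous g) (hc : HasCompactSupport g)
    (p : ℝ) : Decay p g := by
  have h1 : Continuous fun x : Rd d => (1 + ‖x‖) ^ p :=
    Continuous.rpow_const (by fun_prop) fun x => Or.inl (by positivity)
  obtain ⟨C, hC⟩ := (h1.smul hg).bounded_above_of_compact_support hc.smul_left
  refine ⟨C, fun x => ?_⟩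
  have h2 : ‖(1 + ‖x‖) ^ p • g x‖ ≤ C := hC x
  have h3 : 0 < (1 + ‖x‖) ^ p := by positivity
  rw [norm_smul, Real.norm_of_nonneg h3.le] at h2
  rw [Real.rpow_neg (by positivity), ← div_eq_mul_inv, le_div_iff₀ h3, mul_comm]
  exact h2

theorem C1Decay.of_hasCompactSupport {g : Rd d → F} (hg : ContDiff ℝ 1 g)
    (hc : HasCompactSupport g) (p : ℝ) : C1Decay p g :=
  ⟨hg, decay_of_hasCompactSupport hg.continuous hc p,
    decay_of_hasCompactSupport (hg.continuous_fderiv one_ne_zero) (hc.fderiv (𝕜 := ℝ)) (p + 1)⟩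

end

/-- The Riesz transform of a test function is smooth with bounded derivatives. The values in a
normed space allow an induction on the order of differentiation. -/
theorem contDiff_absRiesz_of_hasCompactSupport.{u} (k : ℕ) :
    ∀ {F : Type u} [NormedAddCommGroup F] [NormedSpace ℝ F] {g : Rd d → F},
      ContDiff ℝ (k + 2) g → HasCompactSupport g → ContDiff ℝ k (absRiesz i g) ∧
        ∃ B, ∀ x, ‖iteratedFDeriv ℝ k (absRiesz i g) x‖ ≤ B := by
  induction k with
  | zero =>
    intro F _ _ g hg hc
    have h1 := C1Decay.of_hasCompactSupport (hg.of_le (by norm_num)) hc ((d : ℝ) + 1)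
    obtain ⟨B, hB⟩ := h1.bounded_absRiesz i (by linarith)
    exact ⟨contDiff_zero.2 (h1.continuous_absRiesz i (by linarith)), B, by simpa using hB⟩
  | succ k ih =>
    intro F _ _ g hg hc
    have hg2 : ContDiff ℝ 2 g := hg.of_le (by
      have : ((2 : ℕ) : WithTop ℕ∞) ≤ ((k + 1 + 2 : ℕ) : WithTop ℕ∞) := by
        exact_mod_cast (by lia : 2 ≤ k + 1 + 2)
      exact_mod_cast this)
    have hg' : ContDiff ℝ (k + 2) (fderiv ℝ g) := by
      refine hg.fderiv_right (m := (k : WithTop ℕ∞) + 2) (le_of_eq ?_)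
      push_cast; ring
    have h1 := C1Decay.of_hasCompactSupport (hg2.of_le (by norm_num)) hc ((d : ℝ) + 1)
    have h2 := C1Decay.of_hasCompactSupport (hg2.fderiv_right (m := 1) (by norm_num))
      (hc.fderiv (𝕜 := ℝ)) ((d : ℝ) + 1)
    have hd := fun x => h1.hasFDerivAt_absRiesz i (by linarith) h2 (by linarith) x
    have hfd : fderiv ℝ (absRiesz i g) = absRiesz i (fderiv ℝ g) := funext fun x => (hd x).fderiv
    obtain ⟨h3, B, hB⟩ := ih hg' (hc.fderiv (𝕜 := ℝ))
    refine ⟨?_, B, fun x => ?_⟩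
    · push_cast
      rw [contDiff_succ_iff_fderiv]
      refine ⟨fun x => (hd x).differentiableAt, by simp, ?_⟩
      rwa [hfd]
    · rw [← norm_iteratedFDeriv_fderiv, hfd]
      exact hB x

section

variable {p : ℝ} {f : Rd d → ℝ}

theorem exists_bound_of_forall_exists {φ : ℕ → Rd d → ℝ} (n : ℕ) (h : ∀ k, ∃ B, ∀ z, φ k z ≤ B) :
    ∃ B, ∀ k ≤ n, ∀ z, φ k z ≤ B := by
  choose B hB using h
  refine ⟨∑ k ∈ Finset.range (n + 1), |B k|, fun k hk z =>
    (hB k z).trans ((le_abs_self _).trans ?_)⟩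
  exact Finset.single_le_sum (f := fun k => |B k|) (fun _ _ => abs_nonneg _)
    (Finset.mem_range.2 (by lia))

/-- Decay of the Riesz transform. After rescaling `x` to the unit sphere, the singular part of the
kernel only sees `f` away from the origin, where its gradient is small, and the smooth part only
sees the Taylor remainder of the kernel because of the vanishing moments. -/
theorem C1Decay.decay_absRiesz {n : ℕ} (hf : C1Decay p f) (hm : MomentsVanish (n + 1) f)
    {δ : ℝ} (hδ0 : 0 ≤ δ) (hδ1 : δ ≤ 1) (hp : (d : ℝ) + (n + δ) < p) :
    Decay ((d : ℝ) + (n + δ)) (absRiesz i f) := by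
  have hfc := hf.contDiff.continuous
  have hq0 : (0 : ℝ) ≤ (d : ℝ) + (n + δ) := by positivity
  have hnδ : (0 : ℝ) ≤ n + δ := by positivity
  have hpd : (d : ℝ) < p := by linarith
  have hp0 : 0 ≤ p := by linarith
  set q : ℝ := (d : ℝ) + (n + δ) with hq
  obtain ⟨C₀, hC₀⟩ := hf.bounded_absRiesz i hpd
  have hC₀0 : 0 ≤ C₀ := (norm_nonneg _).trans (hC₀ 0)
  obtain ⟨G, hG0, hG⟩ := hf.decay_fderiv.exists_nonneg
  obtain ⟨C₁, hC₁0, hC₁⟩ := hm.exists_abs_integral_comp_smul_mul_le hf.decay hfc hδ0 hδ1 hp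
  obtain ⟨B, hB⟩ := exists_bound_of_forall_exists
    (φ := fun k z => ‖iteratedFDeriv ℝ k (farKernel i) z‖) (n + 1)
    (exists_norm_iteratedFDeriv_farKernel_le i)
  have hB0 : 0 ≤ B := (norm_nonneg _).trans (hB 0 (by lia) 0)
  set I := ∫ z : Rd d, ‖nearKernel i z * ‖z‖‖ with hI
  have hI0 : 0 ≤ I := integral_nonneg fun z => norm_nonneg _
  refine ⟨C₀ * 2 ^ q + (G * 2 ^ (p + 1) * I + C₁ * B * 2 ^ q), fun x => ?_⟩
  set r := ‖x‖ with hr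
  -- for `r ≥ 1`, powers of `r` and of `1 + r` agree up to the factor `2 ^ s`
  have half : ∀ s : ℝ, 0 ≤ s → ((1 + r) / 2) ^ (-s) = 2 ^ s * (1 + r) ^ (-s) := by
    intro s _
    rw [Real.div_rpow (by positivity) (by norm_num), Real.rpow_neg (by norm_num : (0 : ℝ) ≤ 2),
      div_inv_eq_mul, mul_comm]
  rcases le_total r 1 with hr1 | hr1
  · have h1 : (1 : ℝ) ≤ ((1 + r) / 2) ^ (-q) := by
      refine Real.one_le_rpow_of_pos_of_le_one_of_nonpos (by positivity) (by linarith) (by linarith)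
    rw [half q hq0] at h1
    rw [add_mul]
    have h2 : 0 ≤ (G * 2 ^ (p + 1) * I + C₁ * B * 2 ^ q) * (1 + r) ^ (-q) := by positivity
    have h3 := mul_le_mul_of_nonneg_left h1 hC₀0
    have h4 := hC₀ x
    linarith
  have hr0 : 0 < r := by linarith
  set w : Rd d := r⁻¹ • x with hw
  have hxw : x = r • w := by rw [hw, smul_smul, mul_inv_cancel₀ hr0.ne', one_smul]
  have hwn : ‖w‖ = 1 := by
    rw [hw, norm_smul, norm_inv, Real.norm_of_nonneg hr0.le, ← hr, inv_mul_cancel₀ hr0.ne']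
  have hscale : absRiesz i f x = absRiesz i (fun y => f (r • y)) w := by
    rw [hf.absRiesz_comp_smul i hpd hr0 (hf.comp_smul hp0 hr0), ← hxw]
  -- the singular part
  have hnear : ‖nearRiesz i (fun y => f (r • y)) w‖ ≤ G * 2 ^ (p + 1) * I * (1 + r) ^ (-q) := by
    have hgrad : ∀ y ∈ Metric.ball w (1 / 2),
        ‖fderiv ℝ (fun y => f (r • y)) y‖ ≤ G * 2 ^ (p + 1) * (1 + r) ^ (-q) := by
      intro y hy
      have h1 : fderiv ℝ (fun y => f (r • y)) y = r • fderiv ℝ f (r • y) := fderiv_comp_smul ..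
      have h2 : 1 / 2 ≤ ‖y‖ := by
        rw [mem_ball_iff_norm'] at hy
        have := norm_sub_norm_le w y
        rw [hwn] at this; linarith
      have h3 : (1 + ‖r • y‖) ^ (-(p + 1)) ≤ ((1 + r) / 2) ^ (-(p + 1)) := by
        refine Real.rpow_le_rpow_of_nonpos (by positivity) ?_ (by linarith)
        rw [norm_smul, Real.norm_of_nonneg hr0.le]; nlinarith
      rw [half (p + 1) (by linarith)] at h3
      have h4 : r * (1 + r) ^ (-(p + 1)) ≤ (1 + r) ^ (-q) := by
        have h5 : (1 + r) ^ (-(p + 1)) = (1 + r) ^ (-p) * (1 + r)⁻¹ := by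
          rw [neg_add, Real.rpow_add (by positivity), Real.rpow_neg_one]
        have h6 : r * (1 + r)⁻¹ ≤ 1 := by
          rw [← div_eq_mul_inv, div_le_one (by positivity)]; linarith
        have h7 : (1 + r) ^ (-p) ≤ (1 + r) ^ (-q) :=
          Real.rpow_le_rpow_of_exponent_le (by linarith) (by linarith)
        have h8 : 0 ≤ (1 + r) ^ (-p) := by positivity
        rw [h5]
        calc r * ((1 + r) ^ (-p) * (1 + r)⁻¹) = (1 + r) ^ (-p) * (r * (1 + r)⁻¹) := by ring
          _ ≤ (1 + r) ^ (-p) * 1 := by gcongr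
          _ ≤ _ := by rw [mul_one]; exact h7
      rw [h1, norm_smul, Real.norm_of_nonneg hr0.le]
      calc r * ‖fderiv ℝ f (r • y)‖ ≤ r * (G * (2 ^ (p + 1) * (1 + r) ^ (-(p + 1)))) := by
            gcongr
            exact (hG _).trans (by gcongr)
        _ = G * 2 ^ (p + 1) * (r * (1 + r) ^ (-(p + 1))) := by ring
        _ ≤ _ := by gcongr
    have hfr := (hf.comp_smul hp0 hr0).contDiff.differentiable one_ne_zero
    have hpt : ∀ z, ‖nearKernel i z • (f (r • (w - z)) - f (r • w))‖ ≤
        (G * 2 ^ (p + 1) * (1 + r) ^ (-q)) * ‖nearKernel i z * ‖z‖‖ := by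
      intro z
      rcases le_or_gt (1 / 2) ‖z‖ with hz | hz
      · rw [nearKernel_eq_zero i hz, zero_smul, norm_zero]; positivity
      rw [norm_smul, norm_mul, norm_norm, mul_left_comm]
      gcongr
      have := Convex.norm_image_sub_le_of_norm_fderiv_le (𝕜 := ℝ) (f := fun y => f (r • y))
        (x := w) (y := w - z) (fun y _ => hfr.differentiableAt) hgrad (convex_ball w (1 / 2))
        (Metric.mem_ball_self (by norm_num)) (by simpa [Metric.mem_ball, dist_eq_norm] using hz)
      simpa using this
    refine (norm_integral_le_of_norm_le ((integrable_nearKernel_mul_norm i).norm.const_mul _)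
      (Eventually.of_forall hpt)).trans_eq ?_
    rw [integral_const_mul]; ring
  -- the smooth part
  have hfar : ‖farRiesz i (fun y => f (r • y)) w‖ ≤ C₁ * B * 2 ^ q * (1 + r) ^ (-q) := by
    have h1 : farRiesz i (fun y => f (r • y)) w = -∫ y, f (r • y) * farKernel i (y - w) := by
      rw [farRiesz_eq, ← integral_neg]
      refine integral_congr_ae (Eventually.of_forall fun y => ?_)
      simp only [smul_eq_mul]
      rw [← neg_sub y w, farKernel_neg]; ring
    have h2 := hC₁ (fun y => farKernel i (y - w)) B
      ((contDiff_farKernel i (n := ((n + 1 : ℕ) : ℕ∞))).comp (contDiff_id.sub contDiff_const))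
      (fun k hk z => by rw [iteratedFDeriv_comp_sub]; exact hB k hk _) r hr0
    rw [h1, norm_neg, Real.norm_eq_abs]
    refine h2.trans ?_
    rw [mul_assoc (C₁ * B), ← half q hq0]
    gcongr C₁ * B * ?_
    exact Real.rpow_le_rpow_of_nonpos (by positivity) (by linarith) (by linarith)
  rw [hscale]
  refine (norm_add_le _ _).trans ?_
  have h3 : 0 ≤ C₀ * 2 ^ q * (1 + r) ^ (-q) := by positivity
  rw [add_mul, add_mul]
  linarith

/-- The Riesz transform preserves vanishing moments. The moment of order `β` is the limit of the
moments cut off at scale `R`. By antisymmetry and dilation these are pairings of `f(R ·)` with the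
Riesz transform of a fixed test function, to which the Taylor estimate applies. -/
theorem C1Decay.momentsVanish_absRiesz {n : ℕ} (hf : C1Decay p f) (hm : MomentsVanish (n + 1) f)
    (hp : (d : ℝ) + n < p) : MomentsVanish (n + 1) (absRiesz i f) := by
  -- room for a fractional gain `δ` over the degree `n`
  obtain ⟨δ, hδ0, hδ1, hpδ⟩ : ∃ δ : ℝ, 0 < δ ∧ δ ≤ 1 ∧ (d : ℝ) + (n + δ) < p := by
    refine ⟨min 1 ((p - (d + n)) / 2), lt_min one_pos (by linarith), min_le_left _ _, ?_⟩
    linarith [min_le_right 1 ((p - (d + n)) / 2)]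
  have hfc := hf.contDiff.continuous
  have hpd : (d : ℝ) < p := by linarith [(Nat.cast_nonneg n : (0 : ℝ) ≤ n)]
  have hp0 : 0 ≤ p := (Nat.cast_nonneg d).trans hpd.le
  intro β hβ
  have hβn : order β ≤ n := Nat.lt_succ_iff.1 hβ
  have hAc := hf.continuous_absRiesz i hpd
  have hAi : Integrable (fun x => monomial β x * absRiesz i f x) volume := by
    refine (hf.decay_absRiesz i hm hδ0.le hδ1 hpδ).integrable_monomial_mul hAc ?_
    have : (order β : ℝ) ≤ n := by exact_mod_cast hβn
    linarith
  set g : Rd d → ℝ := fun u => cutoff d u * monomial β u with hg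
  have hgs : ∀ k : ℕ∞, ContDiff ℝ k g := fun k =>
    (cutoff d).contDiff.mul (contDiff_prod fun j _ =>
      ((EuclideanSpace.proj (𝕜 := ℝ) j).contDiff).pow _)
  have hgc : HasCompactSupport g := (cutoff d).hasCompactSupport.mul_right
  have hg1 : C1Decay p g := C1Decay.of_hasCompactSupport (hgs 1) hgc p
  have hAg : ∀ k : ℕ, ContDiff ℝ k (absRiesz i g) ∧
      ∃ B, ∀ x, ‖iteratedFDeriv ℝ k (absRiesz i g) x‖ ≤ B := fun k =>
    contDiff_absRiesz_of_hasCompactSupport i k (hgs ((k + 2 : ℕ) : ℕ∞)) hgc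
  obtain ⟨B, hB⟩ := exists_bound_of_forall_exists
    (φ := fun k z => ‖iteratedFDeriv ℝ k (absRiesz i g) z‖) (n + 1)
    fun k => (hAg k).2
  obtain ⟨C, hC0, hC⟩ := hm.exists_abs_integral_comp_smul_mul_le hf.decay hfc hδ0.le hδ1 hpδ
  have hB0 : 0 ≤ B := (norm_nonneg _).trans (hB 0 (by lia) 0)
  set J : ℝ → ℝ := fun R => ∫ x, cutoff d (R⁻¹ • x) * (monomial β x * absRiesz i f x) with hJ
  have hJlim : Tendsto J atTop (𝓝 (∫ x, monomial β x * absRiesz i f x)) := by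
    refine tendsto_integral_filter_of_dominated_convergence
      (fun x => ‖monomial β x * absRiesz i f x‖) (Eventually.of_forall fun R => ?_)
      (Eventually.of_forall fun R => Eventually.of_forall fun x => ?_) hAi.norm
      (Eventually.of_forall fun x => ?_)
    · have hs : Continuous fun x : Rd d => R⁻¹ • x := continuous_id.const_smul R⁻¹
      exact Continuous.aestronglyMeasurable (((cutoff d).continuous.comp hs).mul
        ((continuous_monomial β).mul hAc))
    · rw [norm_mul, Real.norm_of_nonneg (cutoff d).nonneg]
      exact mul_le_of_le_one_left (norm_nonneg _) (cutoff d).le_one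
    · have h1 : Tendsto (fun R : ℝ => R⁻¹ • x) atTop (𝓝 0) := by
        simpa using (tendsto_inv_atTop_zero (𝕜 := ℝ)).smul_const x
      have h2 := ((cutoff d).continuous.tendsto 0).comp h1
      rw [(cutoff d).eventuallyEq_one.eq_of_nhds] at h2
      simpa using h2.mul_const (monomial β x * absRiesz i f x)
  have hJbound : ∀ R : ℝ, 1 ≤ R → |J R| ≤ C * B * R ^ (-δ) := by
    intro R hR
    have hR0 : 0 < R := by linarith
    have hmono : ∀ u : Rd d, monomial β (R • u) = R ^ order β * monomial β u := by
      intro u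
      simp only [monomial, PiLp.smul_apply, smul_eq_mul, mul_pow, Finset.prod_mul_distrib, order,
        Finset.prod_pow_eq_pow_sum]
    have h1 : J R = R ^ d * ∫ u, cutoff d (R⁻¹ • (R • u)) *
        (monomial β (R • u) * absRiesz i f (R • u)) := by
      rw [integral_comp_smul_mul hR0 (fun x => cutoff d (R⁻¹ • x) *
        (monomial β x * absRiesz i f x)), mul_inv_cancel_left₀ (by positivity)]
    have h2 : J R = R ^ d * (R ^ order β * ∫ u, g u * absRiesz i (fun y => f (R • y)) u) := by
      rw [h1]
      congr 1
      rw [← integral_const_mul]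
      refine integral_congr_ae (Eventually.of_forall fun u => ?_)
      simp only
      rw [hf.absRiesz_comp_smul i hpd hR0 (hf.comp_smul hp0 hR0), smul_smul,
        inv_mul_cancel₀ hR0.ne', one_smul, hmono, hg]
      ring
    rw [integral_mul_absRiesz i (hf.comp_smul hp0 hR0) hg1 hpd] at h2
    have h3 := hC (absRiesz i g) B (hAg (n + 1)).1 hB R hR0
    rw [h2, abs_mul, abs_mul, abs_neg, abs_of_pos (pow_pos hR0 _), abs_of_pos (pow_pos hR0 _)]
    have h4 : R ^ order β ≤ R ^ n := pow_le_pow_right₀ hR hβn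
    calc R ^ d * (R ^ order β * |∫ u, f (R • u) * absRiesz i g u|)
        ≤ R ^ d * (R ^ n * (C * B * R ^ (-((d : ℝ) + (n + δ))))) := by gcongr
      _ = C * B * R ^ (-δ) := by
        have : R ^ (-δ) = R ^ d * R ^ n * R ^ (-((d : ℝ) + (n + δ))) := by
          rw [← Real.rpow_natCast, ← Real.rpow_natCast, ← Real.rpow_add hR0, ← Real.rpow_add hR0]
          congr 1; ring
        rw [this]; ring
  have hJ0 : Tendsto J atTop (𝓝 0) := by
    refine squeeze_zero_norm' (a := fun R => C * B * R ^ (-δ)) ?_ ?_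
    · filter_upwards [eventually_ge_atTop 1] with R hR using hJbound R hR
    · simpa using (tendsto_rpow_neg_atTop hδ0).const_mul (C * B)
  exact tendsto_nhds_unique hJlim hJ0

end

end

/-! ### The class preserved by the Riesz transforms -/

section

variable {d : ℕ} (i : Fin d)

section

variable {F G : Type*} [NormedAddCommGroup F] [NormedAddCommGroup G]

theorem Decay.sum {ι : Type*} (s : Finset ι) {p : ℝ} {f : ι → Rd d → F}
    (h : ∀ j ∈ s, Decay p (f j)) : Decay p (fun x => ∑ j ∈ s, f j x) := by
  classical
  induction s using Finset.induction_on with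
  | empty => exact ⟨0, fun x => by simp⟩
  | insert a s ha ih =>
    simp only [Finset.sum_insert ha]
    exact (h a (Finset.mem_insert_self _ _)).add
      (ih fun j hj => h j (Finset.mem_insert_of_mem hj))

variable [NormedSpace ℝ F] [NormedSpace ℝ G]

theorem C1Decay.clm_comp (L : F →L[ℝ] G) {p : ℝ} {f : Rd d → F} (hf : C1Decay p f) :
    C1Decay p (fun x => L (f x)) := by
  refine ⟨L.contDiff.comp hf.contDiff, hf.decay.clm_comp L, ?_⟩
  have : fderiv ℝ (fun x => L (f x)) =
      fun x => ContinuousLinearMap.compL ℝ (Rd d) F G L (fderiv ℝ f x) := by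
    ext1 x
    exact (L.hasFDerivAt.comp x
      (hf.contDiff.differentiable one_ne_zero).differentiableAt.hasFDerivAt).fderiv
  rw [this]
  exact hf.decay_fderiv.clm_comp _

theorem C1Decay.sum {ι : Type*} (s : Finset ι) {p : ℝ} {f : ι → Rd d → F}
    (h : ∀ j ∈ s, C1Decay p (f j)) : C1Decay p (fun x => ∑ j ∈ s, f j x) := by
  refine ⟨ContDiff.sum fun j hj => (h j hj).contDiff, Decay.sum s fun j hj => (h j hj).decay, ?_⟩
  have : fderiv ℝ (fun x => ∑ j ∈ s, f j x) = fun x => ∑ j ∈ s, fderiv ℝ (f j) x := by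
    ext1 x
    exact fderiv_fun_sum fun j hj =>
      ((h j hj).contDiff.differentiable one_ne_zero).differentiableAt
  rw [this]
  exact Decay.sum s fun j hj => (h j hj).decay_fderiv

end

/-- The partial derivative `∂_i f`, through the Fréchet derivative. -/
def partialD (f : Rd d → ℝ) (x : Rd d) : ℝ := fderiv ℝ f x (EuclideanSpace.single i 1)

/-- The linear map `c ↦ c dx_i`. -/
def smulCoord : ℝ →L[ℝ] (Rd d →L[ℝ] ℝ) :=
  (ContinuousLinearMap.id ℝ ℝ).smulRight (EuclideanSpace.proj (𝕜 := ℝ) i)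

theorem fderiv_eq_sum_partialD (f : Rd d → ℝ) :
    fderiv ℝ f = fun x => ∑ j, smulCoord j (partialD j f x) := by
  ext x v
  have hv : v = ∑ a, v a • EuclideanSpace.single a (1 : ℝ) := by
    have := (EuclideanSpace.basisFun (Fin d) ℝ).sum_repr v
    simpa using this.symm
  conv_lhs => rw [hv, map_sum]
  simp [smulCoord, partialD, mul_comm]

/-- The class on which the Riesz transforms act, losing one derivative (the index `m`) and an
arbitrarily small power (the index `ε`). All derivatives of order `k ≤ m` are
`O((1 + |x|)^{-d-N-k+ε})`, and those of order `k < m` have vanishing moments of order less than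
`N + k`. -/
def RegDecay : ℕ → ℕ → ℝ → (Rd d → ℝ) → Prop
  | 0, N, ε, f => Continuous f ∧ Decay ((d : ℝ) + N - ε) f
  | m + 1, N, ε, f => Decay ((d : ℝ) + N - ε) f ∧ MomentsVanish N f ∧ Differentiable ℝ f ∧
      ∀ j, RegDecay m (N + 1) ε (partialD j f)

theorem RegDecay.continuous {m N : ℕ} {ε : ℝ} {f : Rd d → ℝ} (h : RegDecay m N ε f) :
    Continuous f := by
  cases m with
  | zero => exact h.1
  | succ m => exact h.2.2.1.continuous

theorem RegDecay.decay {m N : ℕ} {ε : ℝ} {f : Rd d → ℝ} (h : RegDecay m N ε f) :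
    Decay ((d : ℝ) + N - ε) f := by
  cases m with
  | zero => exact h.2
  | succ m => exact h.1

theorem RegDecay.mono {m : ℕ} {ε ε' : ℝ} (hε : ε ≤ ε') : ∀ {N : ℕ} {f : Rd d → ℝ},
    RegDecay m N ε f → RegDecay m N ε' f := by
  induction m with
  | zero => exact fun h => ⟨h.1, h.2.mono (by linarith)⟩
  | succ m ih => exact fun h => ⟨h.1.mono (by linarith), h.2.1, h.2.2.1, fun j => ih (h.2.2.2 j)⟩

theorem RegDecay.const_mul (c : ℝ) {m : ℕ} {ε : ℝ} : ∀ {N : ℕ} {f : Rd d → ℝ},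
    RegDecay m N ε f → RegDecay m N ε (fun x => c * f x) := by
  have hdec : ∀ {p : ℝ} {f : Rd d → ℝ}, Decay p f → Decay p (fun x => c * f x) := fun h =>
    h.clm_comp (c • ContinuousLinearMap.id ℝ ℝ)
  induction m with
  | zero => exact fun h => ⟨continuous_const.mul h.1, hdec h.2⟩
  | succ m ih =>
    intro N f h
    refine ⟨hdec h.1, fun β hβ => ?_, h.2.2.1.const_mul c, fun j => ?_⟩
    · simp only [mul_left_comm _ c]
      rw [integral_const_mul, h.2.1 β hβ, mul_zero]
    · have : partialD j (fun x => c * f x) = fun x => c * partialD j f x := by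
        ext x
        rw [partialD, fderiv_const_mul h.2.2.1.differentiableAt]
        rfl
      rw [this]
      exact ih (h.2.2.2 j)

theorem RegDecay.c1Decay {m N : ℕ} {ε : ℝ} {f : Rd d → ℝ} (h : RegDecay (m + 1) N ε f) :
    C1Decay ((d : ℝ) + N - ε) f := by
  refine ⟨?_, h.1, ?_⟩
  · rw [contDiff_one_iff_fderiv]
    refine ⟨h.2.2.1, ?_⟩
    rw [fderiv_eq_sum_partialD]
    exact continuous_finsetSum _ fun j _ => (smulCoord j).continuous.comp (h.2.2.2 j).continuous
  · rw [fderiv_eq_sum_partialD]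
    refine Decay.sum _ fun j _ => Decay.clm_comp (smulCoord j) ?_
    refine (h.2.2.2 j).decay.mono (le_of_eq ?_)
    push_cast; ring

theorem RegDecay.c1Decay_fderiv {m N : ℕ} {ε : ℝ} {f : Rd d → ℝ} (h : RegDecay (m + 2) N ε f) :
    C1Decay ((d : ℝ) + (N + 1 : ℕ) - ε) (fderiv ℝ f) := by
  rw [fderiv_eq_sum_partialD]
  exact C1Decay.sum _ fun j _ => (h.2.2.2 j).c1Decay.clm_comp (smulCoord j)

/-- The Riesz transform costs one derivative and an arbitrarily small power of decay. -/
theorem RegDecay.absRiesz {m : ℕ} {ε ε' : ℝ} (hε0 : 0 ≤ ε) (hε : ε < ε') (hε1 : ε' < 1) :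
    ∀ {n : ℕ} {f : Rd d → ℝ}, RegDecay (m + 1) (n + 1) ε f →
      RegDecay m (n + 1) ε' (absRiesz i f) := by
  have hd : ∀ n : ℕ, (d : ℝ) < (d : ℝ) + (n + 1 : ℕ) - ε := fun n => by
    push_cast; linarith [(Nat.cast_nonneg n : (0 : ℝ) ≤ n)]
  have hdec : ∀ {m n : ℕ} {f : Rd d → ℝ}, RegDecay (m + 1) (n + 1) ε f →
      Decay ((d : ℝ) + (n + 1 : ℕ) - ε') (RieszDecay.absRiesz i f) := by
    intro m n f h
    have := h.c1Decay.decay_absRiesz i h.2.1 (δ := 1 - ε') (by linarith) (by linarith)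
      (by push_cast; linarith)
    refine this.mono (le_of_eq ?_)
    push_cast; ring
  induction m with
  | zero =>
    intro n f h
    exact ⟨h.c1Decay.continuous_absRiesz i (hd n), hdec h⟩
  | succ m ih =>
    intro n f h
    have hder := fun x => h.c1Decay.hasFDerivAt_absRiesz i (hd n) h.c1Decay_fderiv (hd (n + 1)) x
    refine ⟨hdec h, h.c1Decay.momentsVanish_absRiesz i h.2.1 (by push_cast; linarith),
      fun x => (hder x).differentiableAt, fun j => ?_⟩
    have : partialD j (RieszDecay.absRiesz i f) = RieszDecay.absRiesz i (partialD j f) := by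
      ext x
      rw [partialD, (hder x).fderiv]
      exact (absRiesz_clm_comp i (ContinuousLinearMap.apply ℝ ℝ (EuclideanSpace.single j (1 : ℝ)))
        h.c1Decay_fderiv (hd (n + 1)) x).symm
    rw [this]
    exact ih (h.2.2.2 j)

theorem RegDecay.riesz {m : ℕ} {ε ε' : ℝ} (hε0 : 0 ≤ ε) (hε : ε < ε') (hε1 : ε' < 1)
    {n : ℕ} {f : Rd d → ℝ} (h : RegDecay (m + 1) (n + 1) ε f) :
    (∀ x, RieszExistsAt i f x) ∧ RegDecay m (n + 1) ε' (riesz i f) ∧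
      MomentsVanish (n + 1) (riesz i f) := by
  have hd : (d : ℝ) < (d : ℝ) + (n + 1 : ℕ) - ε := by
    push_cast; linarith [(Nat.cast_nonneg n : (0 : ℝ) ≤ n)]
  have he : RieszDecay.riesz i f = fun x => rieszConst d * RieszDecay.absRiesz i f x :=
    funext fun x => h.c1Decay.riesz_eq i hd x
  refine ⟨fun x => h.c1Decay.rieszExistsAt i hd x, ?_, ?_⟩
  · rw [he]
    exact (h.absRiesz i hε0 hε hε1).const_mul _
  · rw [he]
    intro β hβ
    simp only [mul_left_comm _ (rieszConst d)]
    rw [integral_const_mul,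
      h.c1Decay.momentsVanish_absRiesz i h.2.1 (by push_cast; linarith) β hβ, mul_zero]

/-- Iterating the Riesz transforms. Each step spends half of the remaining gap between the
exponents, so that any final `ε' > ε` is reached. Vanishing moments are recorded separately from the class, as
the class does not contain them once all derivatives are used up. -/
theorem RegDecay.rieszWord {M n : ℕ} {ε : ℝ} (hε0 : 0 ≤ ε) {f : Rd d → ℝ}
    (h : RegDecay M (n + 1) ε f) (w : List (Fin d)) : ∀ {m : ℕ}, w.length + m = M →
    ∀ {ε' : ℝ}, ε < ε' → ε' < 1 → RieszWordExists w f ∧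
      RegDecay m (n + 1) ε' (rieszWord w f) ∧ (w ≠ [] → MomentsVanish (n + 1) (rieszWord w f)) := by
  induction w with
  | nil =>
    intro m hm ε' hε _
    simp only [List.length_nil, zero_add] at hm
    subst hm
    exact ⟨trivial, h.mono hε.le, fun h => absurd rfl h⟩
  | cons i w ih =>
    intro m hm ε' hε hε1
    obtain ⟨h1, h2, _⟩ := ih (m := m + 1) (by simp only [List.length_cons] at hm; lia)
      (ε' := (ε + ε') / 2) (by linarith) (by linarith)
    obtain ⟨h3, h4, h5⟩ := h2.riesz i (ε' := ε') (by linarith) (by linarith) hε1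
    exact ⟨⟨h1, h3⟩, h4, fun _ => h5⟩

end

/-! ### Classical partial derivatives and the class `L_{N,M}` -/

section

variable {d : ℕ}

theorem lineDeriv_eq_partialD {f : Rd d → ℝ} (hf : Differentiable ℝ f) (i : Fin d) :
    (fun x => lineDeriv ℝ f x (EuclideanSpace.single i (1 : ℝ))) = partialD i f :=
  funext fun x => (hf x).lineDeriv_eq_fderiv

theorem contDiff_partialD {m : ℕ} {f : Rd d → ℝ} (hf : ContDiff ℝ (m + 1 : ℕ) f) (i : Fin d) :
    ContDiff ℝ m (partialD i f) :=
  (hf.fderiv_right (m := m) (by push_cast; exact le_rfl)).clm_apply contDiff_const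

theorem contDiff_partialWord {M : ℕ} {f : Rd d → ℝ} (hf : ContDiff ℝ M f) (w : List (Fin d)) :
    ∀ {m : ℕ}, w.length + m = M → ContDiff ℝ m (partialWord w f) := by
  induction w with
  | nil =>
    intro m hm
    simp only [List.length_nil, zero_add] at hm
    subst hm
    exact hf
  | cons i w ih =>
    intro m hm
    have h := ih (m := m + 1) (by simp only [List.length_cons] at hm; lia)
    rw [partialWord, lineDeriv_eq_partialD (h.differentiable (by simp))]
    exact contDiff_partialD h i

theorem partialD_comm {f : Rd d → ℝ} (hf : ContDiff ℝ 2 f) (i j : Fin d) :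
    partialD i (partialD j f) = partialD j (partialD i f) := by
  have hd : Differentiable ℝ (fderiv ℝ f) :=
    (hf.fderiv_right (m := 1) (by norm_num)).differentiable one_ne_zero
  have h : ∀ a b : Fin d, ∀ x, partialD a (partialD b f) x =
      fderiv ℝ (fderiv ℝ f) x (EuclideanSpace.single a 1) (EuclideanSpace.single b 1) := by
    intro a b x
    have h1 := ((hd x).hasFDerivAt.clm_apply
      (hasFDerivAt_const (EuclideanSpace.single b (1 : ℝ)) x)).fderiv
    have h2 : partialD a (partialD b f) x = fderiv ℝ (fun y => fderiv ℝ f y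
      (EuclideanSpace.single b (1 : ℝ))) x (EuclideanSpace.single a 1) := rfl
    rw [h2, h1]
    simp
  ext x
  rw [h, h]
  exact (hf.contDiffAt.isSymmSndFDerivAt (by simp)) _ _

/-- Classical partial derivatives of a smooth enough function may be taken in any order. -/
theorem partialWord_eq_of_perm {M : ℕ} {f : Rd d → ℝ} (hf : ContDiff ℝ M f)
    {w w' : List (Fin d)} (h : w.Perm w') (hw : w.length ≤ M) :
    partialWord w f = partialWord w' f := by
  induction h with
  | nil => rfl
  | cons a _ ih =>
    simp only [List.length_cons] at hw
    rw [partialWord, partialWord, ih (by lia)]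
  | swap a b l =>
    simp only [List.length_cons] at hw
    have hl : ContDiff ℝ 2 (partialWord l f) := by
      have := contDiff_partialWord hf l (m := M - l.length) (by lia)
      refine this.of_le ?_
      exact_mod_cast (by lia : 2 ≤ M - l.length)
    have hd : ∀ c, Differentiable ℝ (partialD c (partialWord l f)) := fun c =>
      (contDiff_partialD (m := 1) hl c).differentiable (by simp)
    simp only [partialWord, lineDeriv_eq_partialD (hl.differentiable (by simp)),
      lineDeriv_eq_partialD (hd _)]
    exact partialD_comm hl b a
  | trans h1 _ ih1 ih2 => rw [ih1 hw, ih2 (by rwa [← h1.length_eq])]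

theorem count_word (α : Fin d → ℕ) (i : Fin d) : (word α).count i = α i := by
  simp only [word, List.count_flatMap, Function.comp_def, List.count_replicate, beq_iff_eq]
  rw [← List.ofFn_eq_map, List.sum_ofFn]
  simp

theorem length_word (α : Fin d → ℕ) : (word α).length = order α := by
  simp only [word, List.length_flatMap, List.length_replicate, order]
  rw [← List.ofFn_eq_map, List.sum_ofFn]

theorem perm_word_count (w : List (Fin d)) : w.Perm (word fun i => w.count i) :=
  List.perm_iff_count.2 fun i => (count_word (fun i => w.count i) i).symm

/-- The hypotheses on `D^α f` involve derivatives in the canonical order only; the derivatives taken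
in the class `RegDecay` are brought to this order by symmetry of higher derivatives. -/
theorem MemL.exists_regDecay {N M : ℕ} {f : Rd d → ℝ} (hf : MemL N M f) :
    ∃ ε : ℝ, 0 ≤ ε ∧ ε < 1 ∧ RegDecay M N ε f := by
  obtain ⟨s, hs, hH⟩ := hf.sobolev
  have hcd : ContDiff ℝ M f := contDiff_of_memH hs hH hf.continuous
  obtain ⟨C, ε, _, hε0, hε1, hdec⟩ := hf.decay
  refine ⟨ε, hε0, hε1, ?_⟩
  have hmul : ∀ w : List (Fin d), w.length ≤ M → ∃ α : Fin d → ℕ, order α = w.length ∧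
      partialWord w f = multiDeriv α f := fun w hw =>
    ⟨fun i => w.count i, by rw [← length_word, (perm_word_count w).length_eq],
      partialWord_eq_of_perm hcd (perm_word_count w) hw⟩
  have hdecw : ∀ w : List (Fin d), w.length ≤ M →
      Decay ((d : ℝ) + (N + w.length : ℕ) - ε) (partialWord w f) := by
    intro w hw
    obtain ⟨α, hα, he⟩ := hmul w hw
    refine ⟨C, fun x => ?_⟩
    have h := hdec α (by lia) x
    have hexp : -((d : ℝ) + (N + w.length : ℕ) - ε) = -(d : ℝ) - N - order α + ε := by
      rw [hα]; push_cast; ring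
    rw [he, hexp]
    exact h
  have key : ∀ (m : ℕ) (w : List (Fin d)), w.length + m = M →
      RegDecay m (N + w.length) ε (partialWord w f) := by
    intro m
    induction m with
    | zero =>
      intro w hw
      exact ⟨(contDiff_partialWord hcd w hw).continuous, hdecw w (by lia)⟩
    | succ m ih =>
      intro w hw
      have hdiff : Differentiable ℝ (partialWord w f) :=
        (contDiff_partialWord hcd w hw).differentiable (by simp)
      refine ⟨hdecw w (by lia), fun β hβ => ?_, hdiff, fun j => ?_⟩
      · obtain ⟨α, hα, he⟩ := hmul w (by lia)
        rw [he]
        exact hf.moments α β (by lia) (by lia)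
      · have h := ih (j :: w) (by simp only [List.length_cons]; lia)
        rw [partialWord, lineDeriv_eq_partialD hdiff] at h
        exact h
  exact key M [] (by simp)

end

end

end RieszDecay

open RieszDecay in
theorem mainTheorem3 (d N M : ℕ) (hN : 1 ≤ N) (f : RieszDecay.Rd d → ℝ)
    (hf : RieszDecay.MemL N M f) :
    ∃ ε C : ℝ, 0 < ε ∧ ε < 1 ∧ 0 < C ∧
      ∀ α : Fin d → ℕ, 1 ≤ RieszDecay.order α → RieszDecay.order α ≤ M →
        RieszDecay.HigherRieszExists α f ∧
        (∀ x : RieszDecay.Rd d,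
          |RieszDecay.higherRiesz α f x| ≤ C * (1 + ‖x‖) ^ (-(d : ℝ) - (N : ℝ) + ε)) ∧
        ∀ β : Fin d → ℕ, RieszDecay.order β < N →
          Integrable (fun x : RieszDecay.Rd d =>
            RieszDecay.monomial β x * RieszDecay.higherRiesz α f x) volume ∧
          ∫ x : RieszDecay.Rd d, RieszDecay.monomial β x * RieszDecay.higherRiesz α f x = 0 := by
  obtain ⟨ε₀, h0, h1, hreg⟩ := hf.exists_regDecay
  obtain ⟨n, rfl⟩ : ∃ n, N = n + 1 := ⟨N - 1, by lia⟩
  set ε := (ε₀ + 1) / 2 with hε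
  have hR : ∀ α : Fin d → ℕ, order α ≤ M → RieszWordExists (word α) f ∧
      RegDecay (M - order α) (n + 1) ε (rieszWord (word α) f) ∧
      (word α ≠ [] → MomentsVanish (n + 1) (rieszWord (word α) f)) := fun α hα =>
    hreg.rieszWord h0 (word α) (by rw [length_word]; lia) (by rw [hε]; linarith)
      (by rw [hε]; linarith)
  have hhigher : ∀ α : Fin d → ℕ, order α ≤ M →
      RegDecay (M - order α) (n + 1) ε (higherRiesz α f) := fun α hα =>
    (hR α hα).2.1.const_mul _
  have hbound : ∀ α : Fin d → ℕ, ∃ C : ℝ, 0 ≤ C ∧ (order α ≤ M → ∀ x : Rd d,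
      |higherRiesz α f x| ≤ C * (1 + ‖x‖) ^ (-(d : ℝ) - ((n + 1 : ℕ) : ℝ) + ε)) := by
    intro α
    by_cases hα : order α ≤ M
    · obtain ⟨C, hC0, hC⟩ := (hhigher α hα).decay.exists_nonneg
      refine ⟨C, hC0, fun _ x => ?_⟩
      have he : -(d : ℝ) - ((n + 1 : ℕ) : ℝ) + ε = -((d : ℝ) + (n + 1 : ℕ) - ε) := by ring
      rw [he]
      exact hC x
    · exact ⟨0, le_rfl, fun h => absurd h hα⟩
  choose C hC0 hC using hbound
  -- there are finitely many multi-indices of order at most `M`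
  set S : Finset (Fin d → ℕ) := Fintype.piFinset fun _ => Finset.range (M + 1) with hS
  have hmem : ∀ α : Fin d → ℕ, order α ≤ M → α ∈ S := by
    intro α hα
    rw [hS, Fintype.mem_piFinset]
    intro i
    have : α i ≤ order α := Finset.single_le_sum (f := α) (fun _ _ => Nat.zero_le _)
      (Finset.mem_univ i)
    rw [Finset.mem_range]; lia
  have hsum : 0 ≤ ∑ α ∈ S, C α := Finset.sum_nonneg fun α _ => hC0 α
  refine ⟨ε, 1 + ∑ α ∈ S, C α, by rw [hε]; linarith, by rw [hε]; linarith, by linarith,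
    fun α hα1 hα => ⟨(hR α hα).1, fun x => (hC α hα x).trans ?_, fun β hβ => ⟨?_, ?_⟩⟩⟩
  · gcongr
    have := Finset.single_le_sum (f := C) (fun α _ => hC0 α) (hmem α hα)
    linarith
  · refine (hhigher α hα).decay.integrable_monomial_mul (hhigher α hα).continuous ?_
    have : (order β : ℝ) ≤ n := by exact_mod_cast Nat.lt_succ_iff.1 hβ
    push_cast
    rw [hε]; linarith
  · have hne : word α ≠ [] := fun h => by
      have := length_word α
      rw [h, List.length_nil] at this
      lia
    simp only [higherRiesz, mul_left_comm (monomial β _)]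
    rw [integral_const_mul, (hR α hα).2.2 hne β hβ, mul_zero]
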